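/- Let $Q$ be a meromorphic modular form of weight $4$ on $\mathrm{SL}(2,\mathbb Z)$, and consider the equation $y''=Qy$ on the upper half-plane $\mathbb H$, where $'=d/dz$; write $q=e^{2\pi i z}$, $\rho=(1+\sqrt{-3})/2$, $T=\begin{pmatrix}1&1\\0&1\end{pmatrix}$, $S=\begin{pmatrix}0&-1\\1&0\end{pmatrix}$, and $(f|_k\gamma)(z)=(cz+d)^{-k}f(\gamma z)$ for $\gamma=\begin{pmatrix}a&b\\c&d\end{pmatrix}$. For $p\in\mathbb H$ at which $Q$ has at most a double pole, the local exponents at $p$ are the numbers $1/2\pm\kappa_p$ with $\kappa_p^2-1/4=\lim_{z\to p}(z-p)^2Q(z)$ (so $\kappa_p=1/2$ if $Q$ is holomorphic at $p$). Let $n$ be a positive odd integer, and assume: $(\mathrm H_1)$ at every pole $p\in\mathbb H$ of $Q$, the pole has order at most $2$, the local exponents are $1/2\pm\kappa_p$ with $\kappa_p\in\{\tfrac12,1,\tfrac32,\dots\}$, no solution has a logarithmic singularity at $p$, and $\kappa_p>1/2$ if $p\notin\{i,\rho\}$; moreover $Q$ is holomorphic at the cusp $\infty$ with $Q(\infty)\le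 0$. The local exponents at $\infty$ are denoted by $\pm\kappa_\infty$, i.e. $Q(\infty)=-4\pi^2\kappa_\infty^2$ with $\kappa_\infty\ge0$; $(\mathrm H_2)$ the numbers $\theta_\rho=2\kappa_\rho/3$ and $\theta_i=\kappa_i$ are not integers; and $\kappa_\infty=n/4$. Then, for $\operatorname{Im} z$ large, the equation has solutions of the form $$y_\pm(z)=q^{\pm n/4}\Bigl(1+\sum_{j\ge1}c_j^{\pm}q^j\Bigr),\qquad q^{\pm n/4}=e^{\pm 2\pi i n z/4}.$$ For any such solutions, the squares of the analytic continuations of $y_-$ and $y_+$ are single-valued meromorphic functions $y_-^2$, $y_+^2$ on $\mathbb H$, and there is a constant $c\in\mathbb C$ such that $F=y_-^2+c\,y_+^2$ satisfies $$F\big|_{-2}T=F\big|_{-2}S=-F .$$ In particular, $F^2$ is a meromorphic modular form of weight $-4$ on $\mathrm{SL}(2,\mathbb Z)$ (meromorphic on $\mathbb H$ and at the cusp $\infty$). -/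

import Mathlib

open Complex Filter Topology
open scoped Real UpperHalfPlane MatrixGroups ModularForm

namespace ModularODE

/-- The upper half-plane, as a subset of `ℂ`. -/
def H : Set ℂ := {z | 0 < z.im}

/-- The point `ρ = (1 + √-3) / 2`. -/
noncomputable def rho : ℂ := (1 + (√3 : ℝ) * I) / 2

/-- The nome `q = exp (2 π i z)`. -/
noncomputable def nome (z : ℂ) : ℂ := exp (2 * π * I * z)

/-- The restriction to the upper half-plane of a function on `ℂ`. -/
def onH (f : ℂ → ℂ) : ℍ → ℂ := fun z => f z

/-- Meromorphic modular forms of weight `k` on `SL(2, ℤ)`. A meromorphic function on the upper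
half-plane is represented by its normal form (value `0` at the poles, the correct value at every
other point; values outside the upper half-plane are irrelevant), so that the transformation
law may be imposed at all points. -/
structure IsMeromorphicModularForm (k : ℤ) (f : ℂ → ℂ) : Prop where
  meromorphic : MeromorphicNFOn f H
  slash_eq : ∀ γ : SL(2, ℤ), onH f ∣[k] γ = onH f
  meromorphic_at_cusp : ∃ g : ℂ → ℂ, MeromorphicAt g 0 ∧
    ∃ Y : ℝ, ∀ z : ℂ, Y < z.im → f z = g (nome z)

/-- `p` is a pole of the meromorphic function `f`. -/
def IsPole (f : ℂ → ℂ) (p : ℂ) : Prop := meromorphicOrderAt f p < 0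

/-- `y` is a (single-valued, holomorphic) solution of `y'' = Q y` on the open set `U`. -/
def IsSolutionOn (Q : ℂ → ℂ) (U : Set ℂ) (y : ℂ → ℂ) : Prop :=
  AnalyticOnNhd ℂ y U ∧ ∀ z ∈ U, deriv (deriv y) z = Q z * y z

/-- The local exponents of `y'' = Q y` at `p` are `1/2 ± κ`, `κ ≥ 0`: the coefficient
of `(z - p)⁻²` in `Q` is `κ² - 1/4`, so that the indicial equation `s (s - 1) = κ² - 1/4` has the
roots `1/2 ± κ`. For meromorphic `Q` the existence of the limit says that a pole at `p` has order
at most two; where `Q` is holomorphic, `κ = 1/2`. -/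
def HasLocalExponents (Q : ℂ → ℂ) (p : ℂ) (κ : ℝ) : Prop :=
  0 ≤ κ ∧ Tendsto (fun z => (z - p) ^ 2 * Q z) (𝓝[≠] p) (𝓝 ((κ : ℂ) ^ 2 - 1 / 4))

/-- For local exponents `1/2 ± κ`, `2κ` an integer: no solution of `y'' = Q y` near `p` has a
logarithmic singularity at `p`. That is, every branch of a solution near `p` is
`(z - p) ^ (1/2 - κ) * h z` with `h` holomorphic in a full neighbourhood of `p`; here
`(z - p) ^ a = exp (a * L z)` for a branch `L` of `log (z - p)`. -/
def NoLogAt (Q : ℂ → ℂ) (p : ℂ) (κ : ℝ) : Prop :=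
  ∃ r : ℝ, 0 < r ∧
    ∀ U : Set ℂ, IsOpen U → IsPreconnected U → U ⊆ Metric.ball p r \ {p} →
    ∀ L : ℂ → ℂ, AnalyticOnNhd ℂ L U → (∀ z ∈ U, exp (L z) = z - p) →
    ∀ y : ℂ → ℂ, IsSolutionOn Q U y →
      ∃ h : ℂ → ℂ, AnalyticOnNhd ℂ h (Metric.ball p r) ∧
        ∀ z ∈ U, y z = exp ((1 / 2 - κ) * L z) * h z

/-- The equation is Fuchsian at the cusp `∞` with local exponents `±κ`, `κ ≥ 0`: `Q` is holomorphic
at `∞` and `κ² = -Q(∞) / (4π²)`, the indicial equation of `(q d/dq)² y = -Q / (4π²) y` at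
`q = 0`. In particular `Q(∞) ≤ 0`. -/
def HasExponentsAtInfty (Q : ℂ → ℂ) (κ : ℝ) : Prop :=
  0 ≤ κ ∧ ∃ g : ℂ → ℂ, AnalyticAt ℂ g 0 ∧ g 0 = -4 * (π : ℂ) ^ 2 * (κ : ℂ) ^ 2 ∧
    ∃ Y : ℝ, ∀ z : ℂ, Y < z.im → Q z = g (nome z)

/-- At every pole `p` in the upper half-plane the equation is Fuchsian and apparent with exponents
`1/2 ± κ_p`, `κ_p ∈ {1/2, 1, 3/2, …}`, and `κ_p > 1/2` if `p` is neither `i` nor `ρ`; moreover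
`Q(∞) ≤ 0`, and the exponents at `∞` are `±κ_∞`. -/
structure ConditionH1 (Q : ℂ → ℂ) (κ_infty : ℝ) : Prop where
  apparent : ∀ p ∈ H, IsPole Q p → ∃ κ : ℝ, (∃ m : ℕ, 0 < m ∧ κ = m / 2) ∧
    HasLocalExponents Q p κ ∧ NoLogAt Q p κ ∧ (p ≠ I → p ≠ rho → 1 / 2 < κ)
  exponents_at_infty : HasExponentsAtInfty Q κ_infty

/-- The angles `θ_ρ = 2 κ_ρ / 3` and `θ_i = κ_i` are not integers. -/
structure ConditionH2 (Q : ℂ → ℂ) : Prop where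
  angle_rho : ∃ κ : ℝ, HasLocalExponents Q rho κ ∧ ∀ m : ℤ, 2 * κ / 3 ≠ m
  angle_I : ∃ κ : ℝ, HasLocalExponents Q I κ ∧ ∀ m : ℤ, κ ≠ m

/-- `y` is a solution of `y'' = Q y` for `Im z > Y`, of the form
`y = q ^ s * (1 + ∑_{j ≥ 1} c_j q ^ j)`, where `q ^ s = exp (2 π i s z)`. -/
def IsFrobeniusSolution (Q : ℂ → ℂ) (s : ℝ) (Y : ℝ) (y : ℂ → ℂ) : Prop :=
  IsSolutionOn Q {z | Y < z.im} y ∧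
    ∃ c : ℕ → ℂ, c 0 = 1 ∧ ∀ z : ℂ, Y < z.im →
      HasSum (fun j => c j * nome z ^ j) (y z * exp (-(2 * π * I * s * z)))

/-- `G` is the square of the analytic continuation to the upper half-plane of the solution `y`
given for `Im z > Y`. The continuation of `y` itself may be multi-valued (up to
sign); `G` is a single-valued meromorphic function on the upper half-plane which equals `y²` for
`Im z > Y` and is the square of a solution near every point where `Q` is holomorphic. -/
structure IsSquareOfContinuation (Q : ℂ → ℂ) (Y : ℝ) (y G : ℂ → ℂ) : Prop where
  meromorphic : MeromorphicNFOn G H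
  eq_sq : ∀ z : ℂ, Y < z.im → G z = y z ^ 2
  locally_sq : ∀ z₀ ∈ H, AnalyticAt ℂ Q z₀ →
    ∃ U : Set ℂ, IsOpen U ∧ z₀ ∈ U ∧ ∃ w : ℂ → ℂ, IsSolutionOn Q U w ∧ ∀ z ∈ U, G z = w z ^ 2

end ModularODE

/-!
Near a regular point a solution of `y'' = Q y` is determined up to sign by its square `G`, and
squares are characterized by the equation `2 G G'' - G' ^ 2 = 4 Q G ^ 2`. By (H₁) the local
monodromy at every point of the upper half-plane is `±1`, so that squares of solutions extend
meromorphically across each point: at a pole of `Q` because solutions are `(z - p) ^ (1/2 - κ) h`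
with `h` holomorphic (`exists_extendsSquares_of_noLogAt`), elsewhere because of the existence
theorem for holomorphic equations (`exists_local_basis`). To obtain functions on the whole upper
half-plane one pushes the line `Im z = t` down to the real axis; as `Q` has period one, each line
has a neighbourhood of uniform width into which the continuation is possible, and the identity
theorem makes the pieces fit (`exists_extension`). This yields `A = y₋²`, `C = y₊²`, and, by
polarization, `B = y₋ y₊`.

By Bol's lemma `z ↦ z y (-1 / z)` is again a solution (`IsLocalSol.slash_S`), with the same
Wronskians. Hence `S` operates on the pair `y₋, y₊` by a matrix `(a b; c d)` of determinant one,
and on `A`, `B`, `C` by its symmetric square (`IsSquareTriple.exists_slash_S`). The order of the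
square of a solution at `p` is `1 ± 2 κ_p` (`SquareEq.order_sub_one_sq`), and comparing leading
coefficients at the elliptic fixed points turns (H₂) into two facts:

* at `i` the order is even, so a square which is an eigenvector of `S` in weight `-2` has the
  eigenvalue `-1` (`eq_neg_one_of_slash_S_eq`); all eigenvalues of the matrix therefore have square
  `-1`, and its trace `a + d` vanishes;
* at `ρ` the order is not `1` modulo `3`, so no square is invariant under the element `T S` of
  order three (`not_invariant_at_rho`).

The squares `A` and `C` both change sign under `T`, because `n` is odd. If `c` were zero, `C` would
also change sign under `S`, hence be invariant under `T S`, against the second fact. So `c ≠ 0`,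
and the vanishing of the trace makes `F = A + (b / c) C` change sign under `S`, too
(`IsSquareTriple.exists_anti_invariant`).
-/

namespace ModularODE

/-! ### Identity theorems for meromorphic functions -/

theorem eventuallyEq_nhdsNE_of_isPreconnected {U : Set ℂ} (hU : IsPreconnected U) {f g : ℂ → ℂ}
    (hf : MeromorphicOn f U) (hg : MeromorphicOn g U) {z₀ z : ℂ} (hz₀ : z₀ ∈ U) (hz : z ∈ U)
    (h : f =ᶠ[𝓝[≠] z₀] g) : f =ᶠ[𝓝[≠] z] g := by
  by_contra hne
  have hz' : meromorphicOrderAt (f - g) z ≠ ⊤ := by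
    intro htop
    rw [meromorphicOrderAt_eq_top_iff] at htop
    exact hne (htop.mono fun x hx => sub_eq_zero.1 hx)
  have := (hf.sub hg).meromorphicOrderAt_ne_top_of_isPreconnected hU hz hz₀ hz'
  apply this
  rw [meromorphicOrderAt_eq_top_iff]
  exact h.mono fun x hx => sub_eq_zero.2 hx

theorem eqOn_of_meromorphicNFOn {U : Set ℂ} (hU : IsPreconnected U) {f g : ℂ → ℂ}
    (hf : MeromorphicNFOn f U) (hg : MeromorphicNFOn g U) {z₀ : ℂ} (hz₀ : z₀ ∈ U)
    (h : f =ᶠ[𝓝[≠] z₀] g) : Set.EqOn f g U := fun _ hz =>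
  (((hf hz).eventuallyEq_nhdsNE_iff_eventuallyEq_nhds (hg hz)).1
    (eventuallyEq_nhdsNE_of_isPreconnected hU hf.meromorphicOn hg.meromorphicOn hz₀ hz
      h)).eq_of_nhds

/-! ### The nonlinear equation for squares of solutions -/

/-- `w` is the germ at `z` of a holomorphic solution of `y'' = Q y`. -/
def IsLocalSol (Q w : ℂ → ℂ) (z : ℂ) : Prop :=
  AnalyticAt ℂ w z ∧ ∀ᶠ x in 𝓝 z, deriv (deriv w) x = Q x * w x

/-- Near `z`, the function `G` satisfies the equation `2 G G'' - G' ^ 2 = 4 Q G ^ 2` which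
characterizes the squares of solutions of `y'' = Q y`. -/
def SquareEq (Q G : ℂ → ℂ) (z : ℂ) : Prop :=
  ∀ᶠ x in 𝓝[≠] z, 2 * G x * deriv (deriv G) x - deriv G x ^ 2 = 4 * Q x * G x ^ 2

theorem eventually_deriv_sq {w : ℂ → ℂ} {z : ℂ} (hw : AnalyticAt ℂ w z) :
    ∀ᶠ x in 𝓝 z, deriv (fun y => w y ^ 2) x = 2 * w x * deriv w x ∧
      deriv (deriv (fun y => w y ^ 2)) x = 2 * deriv w x ^ 2 + 2 * w x * deriv (deriv w) x := by
  have h1 : ∀ᶠ x in 𝓝 z, deriv (fun y => w y ^ 2) x = 2 * w x * deriv w x := by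
    filter_upwards [hw.eventually_analyticAt] with x hx
    have := (hx.differentiableAt.hasDerivAt.pow 2).deriv
    simpa [Pi.pow_def] using this
  filter_upwards [h1, h1.eventually_nhds, hw.eventually_analyticAt] with x hx hx' ha
  refine ⟨hx, ?_⟩
  rw [Filter.EventuallyEq.deriv_eq hx']
  have h2 := ((ha.differentiableAt.hasDerivAt.const_mul 2).mul
    ha.deriv.differentiableAt.hasDerivAt).deriv
  rw [show (fun y => 2 * w y * deriv w y) = (fun y => 2 * w y) * deriv w from rfl, h2]
  ring

theorem IsLocalSol.squareEq {Q w G : ℂ → ℂ} {z : ℂ} (hw : IsLocalSol Q w z)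
    (hG : G =ᶠ[𝓝[≠] z] fun x => w x ^ 2) : SquareEq Q G z := by
  filter_upwards [hG, hG.nhdsNE_deriv, hG.nhdsNE_deriv.nhdsNE_deriv,
    (eventually_deriv_sq hw.1).filter_mono nhdsWithin_le_nhds,
    hw.2.filter_mono nhdsWithin_le_nhds] with x h0 h1 h2 h3 h4
  rw [h0, h1, h2, h3.1, h3.2, h4]
  ring

/-- By the identity theorem, being locally the square of a solution is inherited by
meromorphic continuations. -/
theorem SquareEq.of_isPreconnected {Q G : ℂ → ℂ} {U : Set ℂ} (hU : IsPreconnected U)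
    (hQ : MeromorphicOn Q U) (hG : MeromorphicOn G U) {z₀ z : ℂ} (hz₀ : z₀ ∈ U) (hz : z ∈ U)
    (h : SquareEq Q G z₀) : SquareEq Q G z :=
  eventuallyEq_nhdsNE_of_isPreconnected hU
    (f := fun x => 2 * G x * deriv (deriv G) x - deriv G x ^ 2) (g := fun x => 4 * Q x * G x ^ 2)
    ((((MeromorphicOn.const 2).mul hG).mul hG.deriv.deriv).sub (hG.deriv.pow 2))
    (((MeromorphicOn.const 4).mul hQ).mul (hG.pow 2)) hz₀ hz h

/-- The indicial equation of `2 G G'' - G' ^ 2 = 4 Q G ^ 2`: the order of a solution at `p` is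
`1 ± 2 κ`. -/
theorem SquareEq.order_sub_one_sq {Q G : ℂ → ℂ} {p : ℂ} {κ : ℝ} (hG : MeromorphicAt G p)
    (h : SquareEq Q G p) (hκ : HasLocalExponents Q p κ) {m : ℤ}
    (hm : meromorphicOrderAt G p = m) : ((m : ℝ) - 1) ^ 2 = (2 * κ) ^ 2 := by
  obtain ⟨g, hg, hgp, hGg⟩ := (meromorphicOrderAt_eq_int_iff hG).1 hm
  have hGg : G =ᶠ[𝓝[≠] p] fun z => (z - p) ^ m * g z := hGg
  have ht : ∀ᶠ z in 𝓝[≠] p, z - p ≠ 0 := by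
    filter_upwards [self_mem_nhdsWithin] with z hz using sub_ne_zero.2 hz
  have hzp : ∀ z : ℂ, z - p ≠ 0 →
      HasDerivAt (fun z => (z - p) ^ m) ((z - p) ^ m * (m / (z - p))) z := by
    intro z hz
    refine ((hasDerivAt_zpow m (z - p) (Or.inl hz)).comp_sub_const z p).congr_deriv ?_
    rw [zpow_sub_one₀ hz]; field_simp
  have ha : ∀ᶠ z in 𝓝[≠] p, AnalyticAt ℂ g z :=
    hg.eventually_analyticAt.filter_mono nhdsWithin_le_nhds
  have d1 : deriv G =ᶠ[𝓝[≠] p] fun z => (z - p) ^ m * (m / (z - p) * g z + deriv g z) := by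
    filter_upwards [hGg.nhdsNE_deriv, ht, ha] with z h1 h2 h3
    rw [h1]
    refine (((hzp z h2).mul h3.differentiableAt.hasDerivAt).congr_deriv ?_).deriv
    ring
  have d2 : deriv (deriv G) =ᶠ[𝓝[≠] p] fun z => (z - p) ^ m *
      (m * (m - 1) / (z - p) ^ 2 * g z + 2 * m / (z - p) * deriv g z + deriv (deriv g) z) := by
    filter_upwards [d1.nhdsNE_deriv, ht, ha] with z h1 h2 h3
    have hi : HasDerivAt (fun z => (m : ℂ) / (z - p)) (-m / (z - p) ^ 2) z := by
      refine ((((hasDerivAt_id z).sub_const p).inv h2).const_mul (m : ℂ)).congr_deriv ?_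
      simp only [id]
      ring
    rw [h1]
    refine (((hzp z h2).mul ((hi.mul h3.differentiableAt.hasDerivAt).add
      h3.deriv.differentiableAt.hasDerivAt)).congr_deriv ?_).deriv
    simp only [Pi.mul_apply, Pi.add_apply]
    field_simp
    ring
  have key : ∀ᶠ z in 𝓝[≠] p, 2 * g z * (m * (m - 1) * g z + 2 * m * (z - p) * deriv g z
      + (z - p) ^ 2 * deriv (deriv g) z) - (m * g z + (z - p) * deriv g z) ^ 2
      = 4 * ((z - p) ^ 2 * Q z) * g z ^ 2 := by
    filter_upwards [h, hGg, d1, d2, ht] with z h0 h1 h2 h3 h4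
    rw [h1, h2, h3] at h0
    have h5 : ((z - p) ^ m) ^ 2 ≠ 0 := pow_ne_zero _ (zpow_ne_zero _ h4)
    apply mul_left_cancel₀ h5
    field_simp at h0
    linear_combination ((z - p) ^ m) ^ 2 * h0
  have cg := hg.continuousAt.tendsto.mono_left (nhdsWithin_le_nhds (s := {p}ᶜ))
  have cg1 := hg.deriv.continuousAt.tendsto.mono_left (nhdsWithin_le_nhds (s := {p}ᶜ))
  have cg2 := hg.deriv.deriv.continuousAt.tendsto.mono_left (nhdsWithin_le_nhds (s := {p}ᶜ))
  have ct : Tendsto (fun z : ℂ => z - p) (𝓝[≠] p) (𝓝 0) := by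
    have : ContinuousAt (fun z : ℂ => z - p) p := by fun_prop
    simpa using this.tendsto.mono_left (nhdsWithin_le_nhds (s := {p}ᶜ))
  have L := ((cg.const_mul 2).mul (((cg.const_mul ((m : ℂ) * (m - 1))).add
    ((ct.const_mul (2 * (m : ℂ))).mul cg1)).add ((ct.pow 2).mul cg2))).sub
    (((cg.const_mul (m : ℂ)).add (ct.mul cg1)).pow 2)
  have R := ((hκ.2.const_mul 4).mul (cg.pow 2))
  have E := tendsto_nhds_unique (L.congr' key) R
  have h5 : g p ^ 2 ≠ 0 := pow_ne_zero _ hgp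
  have E2 : ((m : ℂ) - 1) ^ 2 = (2 * κ) ^ 2 := by
    apply mul_left_cancel₀ h5
    linear_combination E
  exact_mod_cast E2

theorem hasLocalExponents_of_analyticAt {Q : ℂ → ℂ} {p : ℂ} (hQ : AnalyticAt ℂ Q p) :
    HasLocalExponents Q p (1 / 2) := by
  refine ⟨by norm_num, ?_⟩
  have h : ContinuousAt (fun z => (z - p) ^ 2 * Q z) p := by
    have := hQ.continuousAt
    fun_prop
  have := h.tendsto.mono_left (nhdsWithin_le_nhds (s := {p}ᶜ))
  convert this using 2
  push_cast
  ring

theorem exists_analyticAt_sq_eq {g : ℂ → ℂ} {p : ℂ} (hg : AnalyticAt ℂ g p) (hp : g p ≠ 0) :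
    ∃ s : ℂ → ℂ, AnalyticAt ℂ s p ∧ s p ≠ 0 ∧ ∀ᶠ z in 𝓝 p, s z ^ 2 = g z := by
  obtain ⟨c, hc⟩ := IsAlgClosed.exists_pow_nat_eq (g p) (n := 2) (by norm_num)
  have hc0 : c ≠ 0 := by rintro rfl; exact hp (by simpa using hc.symm)
  have hq : AnalyticAt ℂ (fun z => g z / g p) p := hg.div_const
  refine ⟨fun z => c * exp (log (g z / g p) / 2), ?_, by simp [hc0], ?_⟩
  · refine analyticAt_const.mul (AnalyticAt.cexp (AnalyticAt.div_const (hq.clog ?_)))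
    simp [div_self hp]
  · filter_upwards [hg.continuousAt.eventually_ne hp] with z hz
    rw [mul_pow, hc, ← exp_nat_mul, Nat.cast_ofNat, mul_div_cancel₀ _ two_ne_zero,
      exp_log (div_ne_zero hz hp), mul_div_cancel₀ _ hp]

/-- A meromorphic solution of `2 G G'' - G' ^ 2 = 4 Q G ^ 2` is, near a regular point of `Q`, the
square of a solution of `y'' = Q y`: its order there is `0` or `2`, so that it has a root. -/
theorem SquareEq.exists_isLocalSol {Q G : ℂ → ℂ} {p : ℂ} (hQ : AnalyticAt ℂ Q p)
    (hG : MeromorphicNFAt G p) (h : SquareEq Q G p) :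
    ∃ w : ℂ → ℂ, IsLocalSol Q w p ∧ G =ᶠ[𝓝 p] fun z => w z ^ 2 := by
  by_cases htop : meromorphicOrderAt G p = ⊤
  · refine ⟨fun _ => 0, ⟨analyticAt_const, by simp⟩, ?_⟩
    rw [← hG.eventuallyEq_nhdsNE_iff_eventuallyEq_nhds
      (AnalyticAt.meromorphicNFAt (by fun_prop))]
    rw [meromorphicOrderAt_eq_top_iff] at htop
    filter_upwards [htop] with z hz
    simp [hz]
  obtain ⟨m, hm⟩ := WithTop.ne_top_iff_exists.1 htop
  have hsq := h.order_sub_one_sq hG.meromorphicAt (hasLocalExponents_of_analyticAt hQ) hm.symm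
  have hm2 : ∃ k : ℕ, m = 2 * k := by
    have h1 : (m - 1) ^ 2 = 1 := by
      have : ((m : ℝ) - 1) ^ 2 = 1 := by rw [hsq]; norm_num
      exact_mod_cast this
    rcases sq_eq_sq_iff_eq_or_eq_neg.1 (h1.trans (one_pow 2).symm) with h | h
    · exact ⟨1, by push_cast; omega⟩
    · exact ⟨0, by push_cast; omega⟩
  obtain ⟨k, rfl⟩ := hm2
  obtain ⟨g, hg, hgp, hGg⟩ := (meromorphicOrderAt_eq_int_iff hG.meromorphicAt).1 hm.symm
  obtain ⟨s, hs, hsp, hsg⟩ := exists_analyticAt_sq_eq hg hgp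
  have hw : AnalyticAt ℂ (fun z => (z - p) ^ k * s z) p := by fun_prop
  set w : ℂ → ℂ := fun z => (z - p) ^ k * s z with hwdef
  have hGw : G =ᶠ[𝓝 p] fun z => w z ^ 2 := by
    rw [← hG.eventuallyEq_nhdsNE_iff_eventuallyEq_nhds
      (g := fun z => w z ^ 2) (AnalyticAt.meromorphicNFAt (hw.pow 2))]
    filter_upwards [hGg, hsg.filter_mono nhdsWithin_le_nhds] with z h1 h2
    rw [h1, ← h2, hwdef]
    simp only [smul_eq_mul]
    rw [show (2 * (k : ℤ)) = ((k * 2 : ℕ) : ℤ) by push_cast; ring, zpow_natCast]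
    ring
  refine ⟨w, ⟨hw, ?_⟩, hGw⟩
  have hne : ∀ᶠ z in 𝓝[≠] p, w z ≠ 0 := by
    filter_upwards [self_mem_nhdsWithin,
      (hs.continuousAt.eventually_ne hsp).filter_mono nhdsWithin_le_nhds] with z h1 h2
    exact mul_ne_zero (pow_ne_zero _ (sub_ne_zero.2 h1)) h2
  have hpunct : deriv (deriv w) =ᶠ[𝓝[≠] p] fun z => Q z * w z := by
    have hGw' := hGw.filter_mono (nhdsWithin_le_nhds (s := {p}ᶜ))
    filter_upwards [hne, h, hGw', hGw'.nhdsNE_deriv, hGw'.nhdsNE_deriv.nhdsNE_deriv,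
      (eventually_deriv_sq hw).filter_mono nhdsWithin_le_nhds] with z h0 h1 h2 h3 h4 h5
    rw [h2, h3, h4, h5.1, h5.2] at h1
    have h6 : 4 * w z ^ 3 ≠ 0 := mul_ne_zero (by norm_num) (pow_ne_zero _ h0)
    apply mul_left_cancel₀ h6
    linear_combination h1
  exact (AnalyticAt.meromorphicNFAt (hw.deriv.deriv)).eventuallyEq_nhdsNE_iff_eventuallyEq_nhds
    (AnalyticAt.meromorphicNFAt (hQ.mul hw)) |>.1 hpunct

/-! ### Frobenius' method -/

/-- A linear recurrence `d j * c j = ∑ b (j - k) * c k` with geometrically bounded coefficients has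
a geometrically bounded solution, if the divisors `d j` are bounded away from zero, an
unobstructed resonance in degree one being allowed. -/
theorem exists_bounded_recurrence (b d : ℕ → ℂ) {M r δ : ℝ} (hM : 0 ≤ M) (hr : 0 ≤ r) (hδ : 0 < δ)
    (hb : ∀ k, ‖b k‖ ≤ M * r ^ k) (hb0 : b 0 = 0) (hd0 : d 0 = 0)
    (hd : ∀ j, 1 ≤ j → δ ≤ ‖d j‖ ∨ (j = 1 ∧ d 1 = 0 ∧ b 1 = 0)) :
    ∃ c : ℕ → ℂ, c 0 = 1 ∧
      (∀ j, d j * c j = ∑ kl ∈ Finset.HasAntidiagonal.antidiagonal j, b kl.1 * c kl.2) ∧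
      ∃ K : ℝ, 0 ≤ K ∧ ∀ j, ‖c j‖ ≤ K ^ j := by
  -- at a resonance the divisor is replaced by `δ`, which leaves the coefficient equal to zero
  let d' : ℕ → ℂ := fun j => if d j = 0 then δ else d j
  have hd' : ∀ j, 1 ≤ j → δ ≤ ‖d' j‖ := by
    intro j hj
    by_cases h : d j = 0
    · simp [d', h, abs_of_pos hδ]
    · rcases hd j hj with h1 | ⟨rfl, h1, -⟩
      · simpa [d', h] using h1
      · exact absurd h1 h
  let c : ℕ → ℂ := fun j => Nat.strongRec (motive := fun _ => ℂ)
    (fun j ih => if j = 0 then 1 else (∑ k : Fin j, b (j - k) * ih k k.2) / d' j) j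
  have hc : ∀ j, c j = if j = 0 then 1 else (∑ k : Fin j, b (j - k) * c k) / d' j := by
    intro j
    simp only [c]
    rw [Nat.strongRec_eq]
  have hc0 : c 0 = 1 := by rw [hc]; simp
  have hcj : ∀ j, 1 ≤ j → c j = (∑ k ∈ Finset.range j, b (j - k) * c k) / d' j := by
    intro j hj
    rw [hc, if_neg (by omega), Fin.sum_univ_eq_sum_range (fun k => b (j - k) * c k)]
  have hanti : ∀ j, ∑ kl ∈ Finset.HasAntidiagonal.antidiagonal j, b kl.1 * c kl.2
      = ∑ k ∈ Finset.range j, b (j - k) * c k := by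
    intro j
    rw [← Finset.Nat.sum_antidiagonal_swap, Finset.Nat.sum_antidiagonal_eq_sum_range_succ_mk,
      Finset.sum_range_succ]
    simp [hb0]
  refine ⟨c, hc0, ?_, r * (1 + M / δ), by positivity, ?_⟩
  · intro j
    rw [hanti]
    rcases Nat.eq_zero_or_pos j with rfl | hj
    · simp [hd0]
    by_cases h : d j = 0
    · rcases hd j hj with h1 | ⟨rfl, h1, h2⟩
      · rw [h, norm_zero] at h1; linarith
      · simp [h1, h2]
    · rw [hcj j hj]
      have : d' j = d j := by simp [d', h]
      rw [this, mul_div_cancel₀ _ h]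
  · set K := r * (1 + M / δ) with hK
    have hK0 : 0 ≤ K := by positivity
    -- geometric majorant of the right-hand side of the recurrence
    have maj : ∀ j, ∑ k ∈ Finset.range j, M * r ^ (j - k) * K ^ k ≤ δ * K ^ j := by
      intro j
      induction j with
      | zero => simpa using hδ.le
      | succ j ih =>
        rw [Finset.sum_range_succ]
        have : ∑ k ∈ Finset.range j, M * r ^ (j + 1 - k) * K ^ k
            = r * ∑ k ∈ Finset.range j, M * r ^ (j - k) * K ^ k := by
          rw [Finset.mul_sum]
          refine Finset.sum_congr rfl fun k hk => ?_
          rw [Nat.succ_sub (Finset.mem_range.1 hk).le, pow_succ]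
          ring
        rw [this, show j + 1 - j = 1 by omega]
        have e : δ * K ^ (j + 1) = r * (δ * K ^ j) + M * r ^ 1 * K ^ j := by
          rw [pow_succ, hK]; field_simp
        rw [e]
        gcongr
    intro j
    induction j using Nat.strong_induction_on with
    | _ j ih =>
      rcases Nat.eq_zero_or_pos j with rfl | hj
      · simp [hc0]
      rw [hcj j hj, norm_div, div_le_iff₀ (hδ.trans_le (hd' j hj))]
      calc ‖∑ k ∈ Finset.range j, b (j - k) * c k‖
          ≤ ∑ k ∈ Finset.range j, M * r ^ (j - k) * K ^ k := by
            refine norm_sum_le_of_le _ fun k hk => ?_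
            rw [norm_mul]
            gcongr
            · exact hb _
            · exact ih k (Finset.mem_range.1 hk)
        _ ≤ δ * K ^ j := maj j
        _ ≤ K ^ j * ‖d' j‖ := by
            rw [mul_comm]
            gcongr
            exact hd' j hj

theorem summable_norm_of_hasSum_ball {c : ℕ → ℂ} {f : ℂ → ℂ} {r : ℝ}
    (h : ∀ x ∈ Metric.ball (0 : ℂ) r, HasSum (fun j => c j * x ^ j) (f x)) {s : ℝ} (hs : 0 ≤ s)
    (hsr : s < r) : Summable fun j => ‖c j‖ * s ^ j := by
  have := (h (s : ℂ) (by simpa [abs_of_nonneg hs] using hsr)).summable.norm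
  simpa [abs_of_nonneg hs] using this

theorem hasSum_deriv_of_hasSum_ball {c : ℕ → ℂ} {f : ℂ → ℂ} {r : ℝ}
    (h : ∀ x ∈ Metric.ball (0 : ℂ) r, HasSum (fun j => c j * x ^ j) (f x)) :
    ∀ x ∈ Metric.ball (0 : ℂ) r, AnalyticAt ℂ f x ∧
      HasSum (fun j : ℕ => (j * c j) * x ^ j) (x * deriv f x) := by
  intro x hx
  obtain ⟨s, hxs, hsr⟩ := exists_between (mem_ball_zero_iff.1 hx)
  have hs : 0 ≤ s := (norm_nonneg x).trans hxs.le
  have hu := summable_norm_of_hasSum_ball h hs hsr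
  have hle : ∀ (i : ℕ) (w : ℂ), w ∈ Metric.ball (0 : ℂ) s → ‖c i * w ^ i‖ ≤ ‖c i‖ * s ^ i := by
    intro i w hw
    rw [norm_mul, norm_pow]
    gcongr
    exact (mem_ball_zero_iff.1 hw).le
  have hxs' : x ∈ Metric.ball (0 : ℂ) s := mem_ball_zero_iff.2 hxs
  have hd : ∀ i : ℕ, DifferentiableOn ℂ (fun w : ℂ => c i * w ^ i) (Metric.ball 0 s) := by
    intro i; fun_prop
  have hsum := Complex.hasSum_deriv_of_summable_norm hu hd Metric.isOpen_ball hle hxs'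
  have hdiff := Complex.differentiableOn_tsum_of_summable_norm hu hd Metric.isOpen_ball hle
  have heq : Set.EqOn (fun w => ∑' i, c i * w ^ i) f (Metric.ball 0 s) := fun w hw =>
    (h w (Metric.ball_subset_ball hsr.le hw)).tsum_eq
  have hnhds : (fun w => ∑' i, c i * w ^ i) =ᶠ[𝓝 x] f :=
    heq.eventuallyEq_of_mem (Metric.isOpen_ball.mem_nhds hxs')
  refine ⟨((hdiff.analyticAt (Metric.isOpen_ball.mem_nhds hxs')).congr hnhds), ?_⟩
  rw [hnhds.deriv_eq] at hsum
  have hterm : (fun j : ℕ => (j * c j) * x ^ j)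
      = fun j => x * deriv (fun w : ℂ => c j * w ^ j) x := by
    funext j
    have : deriv (fun w : ℂ => c j * w ^ j) x = c j * (j * x ^ (j - 1)) := by simp
    rw [this]
    rcases j with _ | j
    · simp
    · simp only [Nat.add_sub_cancel, pow_succ]; ring
  rw [hterm]
  exact hsum.mul_left x

/-- Frobenius' method for the equation `x² u'' + (1 + e) x u' = B u`, `B 0 = 0`, at `x = 0`, in the
exponent `0`. A resonance in degree one is allowed if the obstruction, the linear coefficient of
`B`, vanishes. -/
theorem exists_frobenius {B : ℂ → ℂ} (hB : AnalyticAt ℂ B 0) (hB0 : B 0 = 0) (e : ℂ) {δ : ℝ}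
    (hδ : 0 < δ)
    (he : ∀ j : ℕ, 1 ≤ j → δ ≤ ‖(j : ℂ) ^ 2 + e * j‖ ∨ (j = 1 ∧ e = -1 ∧ deriv B 0 = 0)) :
    ∃ r : ℝ, 0 < r ∧ ∃ (c : ℕ → ℂ) (u : ℂ → ℂ), c 0 = 1 ∧ u 0 = 1 ∧
      ∀ x ∈ Metric.ball (0 : ℂ) r, HasSum (fun j => c j * x ^ j) (u x) ∧ AnalyticAt ℂ u x ∧
        x ^ 2 * deriv (deriv u) x + (1 + e) * x * deriv u x = B x * u x := by
  obtain ⟨p, hp⟩ := hB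
  have hpe := hasFPowerSeriesAt_iff.1 hp
  obtain ⟨r₀, hr₀, hball⟩ := Metric.eventually_nhds_iff_ball.1 hpe
  have hbsum : ∀ x ∈ Metric.ball (0 : ℂ) r₀, HasSum (fun j => p.coeff j * x ^ j) (B x) := by
    intro x hx
    simpa [mul_comm] using hball x hx
  have hb0 : p.coeff 0 = 0 := by
    rw [← hB0, ← hp.coeff_zero (fun _ => 1)]; rfl
  have hb1 : p.coeff 1 = deriv B 0 := hp.deriv.symm
  have hs := summable_norm_of_hasSum_ball hbsum (s := r₀ / 2) (by positivity) (by linarith)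
  obtain ⟨M, hM⟩ := hs.tendsto_atTop_zero.bddAbove_range
  have hM' : ∀ k, ‖p.coeff k‖ ≤ M * ((r₀ / 2)⁻¹) ^ k := by
    intro k
    have := hM ⟨k, rfl⟩
    simp only at this
    rw [inv_pow, ← div_eq_mul_inv, le_div_iff₀ (by positivity)]
    exact this
  have hM0 : 0 ≤ M := by
    have := (norm_nonneg _).trans (hM' 0)
    simpa using this
  obtain ⟨c, hc0, hrec, K, hK0, hK⟩ := exists_bounded_recurrence p.coeff
    (fun j => (j : ℂ) ^ 2 + e * j) hM0 (by positivity) hδ hM' hb0 (by simp) (by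
      intro j hj
      rcases he j hj with h | ⟨h1, h2, h3⟩
      · exact Or.inl h
      · exact Or.inr ⟨h1, by simp [h2], by rw [hb1, h3]⟩)
  let u : ℂ → ℂ := fun x => ∑' j, c j * x ^ j
  have hr : 0 < min r₀ (K + 1)⁻¹ := by positivity
  have husum : ∀ x ∈ Metric.ball (0 : ℂ) (min r₀ (K + 1)⁻¹),
      HasSum (fun j => c j * x ^ j) (u x) := by
    intro x hx
    refine Summable.hasSum (Summable.of_norm_bounded (g := fun j : ℕ => (K * ‖x‖) ^ j) ?_ ?_)
    · apply summable_geometric_of_lt_one (by positivity)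
      have h1 : ‖x‖ < (K + 1)⁻¹ := (mem_ball_zero_iff.1 hx).trans_le (min_le_right _ _)
      have h2 : (K + 1) * ‖x‖ < 1 := by
        rwa [← lt_inv_mul_iff₀ (by positivity), mul_one]
      nlinarith [norm_nonneg x]
    · intro j
      rw [norm_mul, norm_pow, mul_pow]
      gcongr
      exact hK j
  refine ⟨_, hr, c, u, hc0, ?_, ?_⟩
  · simp only [u]
    rw [tsum_eq_single 0]
    · simp [hc0]
    · intro j hj; simp [hj]
  intro x hx
  obtain ⟨ha, h1⟩ := hasSum_deriv_of_hasSum_ball husum x hx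
  have h2 := (hasSum_deriv_of_hasSum_ball
    (f := fun x => x * deriv u x) (fun y hy => (hasSum_deriv_of_hasSum_ball husum y hy).2) x hx).2
  refine ⟨husum x hx, ha, ?_⟩
  have hder : deriv (fun x => x * deriv u x) x = deriv u x + x * deriv (deriv u) x := by
    refine (((hasDerivAt_id x).mul ha.deriv.differentiableAt.hasDerivAt).congr_deriv ?_).deriv
    simp
  have hL := h2.add (h1.mul_left e)
  have hxr₀ : x ∈ Metric.ball (0 : ℂ) r₀ := Metric.ball_subset_ball (min_le_left _ _) hx
  have hprod := tsum_mul_tsum_eq_tsum_sum_antidiagonal_of_summable_norm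
    (hbsum x hxr₀).summable.norm (husum x hx).summable.norm
  rw [(hbsum x hxr₀).tsum_eq, (husum x hx).tsum_eq] at hprod
  rw [hprod]
  have hterm : ∀ j : ℕ, ∑ kl ∈ Finset.HasAntidiagonal.antidiagonal j,
      p.coeff kl.1 * x ^ kl.1 * (c kl.2 * x ^ kl.2) =
      (j * (j * c j)) * x ^ j + e * ((j * c j) * x ^ j) := by
    intro j
    have : ∑ kl ∈ Finset.HasAntidiagonal.antidiagonal j,
          p.coeff kl.1 * x ^ kl.1 * (c kl.2 * x ^ kl.2)
        = (∑ kl ∈ Finset.HasAntidiagonal.antidiagonal j, p.coeff kl.1 * c kl.2) * x ^ j := by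
      rw [Finset.sum_mul]
      refine Finset.sum_congr rfl fun kl hkl => ?_
      rw [← Finset.HasAntidiagonal.mem_antidiagonal.1 hkl, pow_add]
      ring
    rw [this, ← hrec]
    ring
  simp only [hterm]
  rw [hL.tsum_eq, hder]
  ring

theorem isSolutionOn_of_punctured {Q y : ℂ → ℂ} {p : ℂ} {r : ℝ}
    (hQ : AnalyticOnNhd ℂ Q (Metric.ball p r)) (hy : AnalyticOnNhd ℂ y (Metric.ball p r))
    (h : ∀ z ∈ Metric.ball p r, z ≠ p → deriv (deriv y) z = Q z * y z) :
    IsSolutionOn Q (Metric.ball p r) y := by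
  refine ⟨hy, fun z hz => ?_⟩
  by_cases hzp : z = p
  · subst hzp
    have hpunct : deriv (deriv y) =ᶠ[𝓝[≠] z] fun x => Q x * y x := by
      filter_upwards [(Metric.isOpen_ball.mem_nhds hz : Metric.ball z r ∈ 𝓝 z)
        |> nhdsWithin_le_nhds, self_mem_nhdsWithin] with x h1 h2 using h x h1 h2
    exact (((hy z hz).deriv.deriv.meromorphicNFAt).eventuallyEq_nhdsNE_iff_eventuallyEq_nhds
      (((hQ z hz).mul (hy z hz)).meromorphicNFAt) |>.1 hpunct).eq_of_nhds
  · exact h z hz hzp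

/-! ### Local solutions -/

/-- The Wronskian `f g' - f' g`. -/
noncomputable def wronskian (f g : ℂ → ℂ) (z : ℂ) : ℂ := f z * deriv g z - deriv f z * g z

theorem IsSolutionOn.wronskian_eq {Q f g : ℂ → ℂ} {U : Set ℂ} (hU : IsOpen U)
    (hc : IsPreconnected U) (hf : IsSolutionOn Q U f) (hg : IsSolutionOn Q U g) {x y : ℂ}
    (hx : x ∈ U) (hy : y ∈ U) : wronskian f g x = wronskian f g y := by
  have hd : ∀ z ∈ U, HasDerivAt (wronskian f g) 0 z := by
    intro z hz
    have f0 := (hf.1 z hz).differentiableAt.hasDerivAt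
    have f1 := (hf.1 z hz).deriv.differentiableAt.hasDerivAt
    have g0 := (hg.1 z hz).differentiableAt.hasDerivAt
    have g1 := (hg.1 z hz).deriv.differentiableAt.hasDerivAt
    refine ((f0.mul g1).sub (f1.mul g0)).congr_deriv ?_
    rw [hf.2 z hz, hg.2 z hz]
    ring
  exact hU.is_const_of_deriv_eq_zero hc
    (fun z hz => (hd z hz).differentiableAt.differentiableWithinAt)
    (fun z hz => (hd z hz).deriv) hx hy

theorem IsLocalSol.exists_ball {Q w : ℂ → ℂ} {z : ℂ} (h : IsLocalSol Q w z) :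
    ∀ᶠ s : ℝ in 𝓝[>] 0, IsSolutionOn Q (Metric.ball z s) w := by
  obtain ⟨s, hs, hball⟩ := Metric.eventually_nhds_iff_ball.1 (h.1.eventually_analyticAt.and h.2)
  filter_upwards [Ioo_mem_nhdsGT hs] with t ht
  exact ⟨fun x hx => (hball x (Metric.ball_subset_ball ht.2.le hx)).1,
    fun x hx => (hball x (Metric.ball_subset_ball ht.2.le hx)).2⟩

theorem IsSolutionOn.isLocalSol {Q w : ℂ → ℂ} {U : Set ℂ} (hU : IsOpen U)
    (h : IsSolutionOn Q U w) {z : ℂ} (hz : z ∈ U) : IsLocalSol Q w z :=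
  ⟨h.1 z hz, by filter_upwards [hU.mem_nhds hz] with x hx using h.2 x hx⟩

theorem IsSolutionOn.mono {Q w : ℂ → ℂ} {U V : Set ℂ} (h : IsSolutionOn Q U w) (hV : V ⊆ U) :
    IsSolutionOn Q V w := ⟨h.1.mono hV, fun z hz => h.2 z (hV hz)⟩

theorem IsLocalSol.eventually_wronskian_eq {Q f g : ℂ → ℂ} {z : ℂ} (hf : IsLocalSol Q f z)
    (hg : IsLocalSol Q g z) : ∀ᶠ x in 𝓝 z, wronskian f g x = wronskian f g z := by
  obtain ⟨s, ⟨hf', hg'⟩, hs⟩ := ((hf.exists_ball.and hg.exists_ball).and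
    self_mem_nhdsWithin).exists
  filter_upwards [Metric.ball_mem_nhds z hs] with x hx
  exact hf'.wronskian_eq Metric.isOpen_ball (convex_ball z s).isPreconnected hg' hx
    (Metric.mem_ball_self hs)

theorem IsLocalSol.exists_eq_combination {Q f g w : ℂ → ℂ} {z : ℂ} (hf : IsLocalSol Q f z)
    (hg : IsLocalSol Q g z) (hw : IsLocalSol Q w z) (hW : wronskian f g z ≠ 0) :
    ∃ a b : ℂ, w =ᶠ[𝓝 z] fun x => a * f x + b * g x := by
  refine ⟨wronskian w g z / wronskian f g z, wronskian f w z / wronskian f g z, ?_⟩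
  filter_upwards [hf.eventually_wronskian_eq hg, hw.eventually_wronskian_eq hg,
    hf.eventually_wronskian_eq hw] with x h1 h2 h3
  field_simp
  rw [← h1, ← h2, ← h3]
  simp only [wronskian]
  ring

theorem IsLocalSol.combination {Q f g : ℂ → ℂ} {z : ℂ} (hf : IsLocalSol Q f z)
    (hg : IsLocalSol Q g z) (a b : ℂ) : IsLocalSol Q (fun x => a * f x + b * g x) z := by
  refine ⟨(analyticAt_const.mul hf.1).add (analyticAt_const.mul hg.1), ?_⟩
  have h1 : ∀ᶠ x in 𝓝 z, deriv (fun x => a * f x + b * g x) x = a * deriv f x + b * deriv g x := by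
    filter_upwards [hf.1.eventually_analyticAt, hg.1.eventually_analyticAt] with x h1 h2
    exact ((h1.differentiableAt.hasDerivAt.const_mul a).add
      (h2.differentiableAt.hasDerivAt.const_mul b)).deriv
  filter_upwards [h1.eventually_nhds, hf.1.eventually_analyticAt, hg.1.eventually_analyticAt,
    hf.2, hg.2] with x h0 h1 h2 h3 h4
  rw [Filter.EventuallyEq.deriv_eq h0]
  refine ((h1.deriv.differentiableAt.hasDerivAt.const_mul a).add
      (h2.deriv.differentiableAt.hasDerivAt.const_mul b)).deriv.trans ?_
  rw [h3, h4]
  ring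

theorem IsSolutionOn.add {Q f g : ℂ → ℂ} {U : Set ℂ} (hU : IsOpen U) (hf : IsSolutionOn Q U f)
    (hg : IsSolutionOn Q U g) : IsSolutionOn Q U (fun z => f z + g z) := by
  refine ⟨hf.1.add hg.1, fun z hz => ?_⟩
  have := ((hf.isLocalSol hU hz).combination (hg.isLocalSol hU hz) 1 1).2.self_of_nhds
  simpa using this

/-! ### Existence of solutions at regular points and at the cusp -/

/-- Near a regular point there are two linearly independent solutions. -/
theorem exists_local_basis {Q : ℂ → ℂ} {p : ℂ} (hQ : AnalyticAt ℂ Q p) :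
    ∃ r : ℝ, 0 < r ∧ ∃ f g : ℂ → ℂ, IsSolutionOn Q (Metric.ball p r) f ∧
      IsSolutionOn Q (Metric.ball p r) g ∧ ∀ z ∈ Metric.ball p r, wronskian f g z ≠ 0 := by
  obtain ⟨r₀, hr₀, hball⟩ := Metric.eventually_nhds_iff_ball.1 hQ.eventually_analyticAt
  have hQ' : AnalyticAt ℂ (fun x => Q (p + x)) 0 := by
    refine AnalyticAt.fun_comp (by simpa using hQ) (by fun_prop)
  have hB : AnalyticAt ℂ (fun x => x ^ 2 * Q (p + x)) 0 :=
    (analyticAt_id.pow 2).mul hQ'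
  have hB1 : deriv (fun x => x ^ 2 * Q (p + x)) 0 = 0 := by
    refine ((((hasDerivAt_id (0 : ℂ)).pow 2).mul
      hQ'.differentiableAt.hasDerivAt).congr_deriv ?_).deriv
    simp
  obtain ⟨r₁, hr₁, _, u₁, -, hu₁, h₁⟩ := exists_frobenius hB (by simp) (-1) (δ := 1) one_pos (by
    intro j hj
    rcases eq_or_lt_of_le hj with rfl | hj
    · exact Or.inr ⟨rfl, rfl, hB1⟩
    · left
      have : (j : ℂ) ^ 2 + -1 * j = ((j * (j - 1) : ℕ) : ℂ) := by
        rw [Nat.cast_mul, Nat.cast_sub (by omega)]; push_cast; ring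
      rw [this, Complex.norm_natCast]
      have : 1 ≤ j * (j - 1) := Nat.one_le_iff_ne_zero.2 (Nat.mul_ne_zero (by omega) (by omega))
      exact_mod_cast this)
  obtain ⟨r₂, hr₂, _, u₂, -, hu₂, h₂⟩ := exists_frobenius hB (by simp) 1 (δ := 1) one_pos (by
    intro j hj
    left
    have : (j : ℂ) ^ 2 + 1 * j = ((j * (j + 1) : ℕ) : ℂ) := by push_cast; ring
    rw [this, Complex.norm_natCast]
    have : 1 ≤ j * (j + 1) := Nat.one_le_iff_ne_zero.2 (Nat.mul_ne_zero (by omega) (by omega))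
    exact_mod_cast this)
  set r := min r₀ (min r₁ r₂) with hr
  have hr0 : 0 < r := by positivity
  have hsub : ∀ z ∈ Metric.ball p r, z ∈ Metric.ball p r₀ ∧ z - p ∈ Metric.ball (0 : ℂ) r₁ ∧
      z - p ∈ Metric.ball (0 : ℂ) r₂ := by
    intro z hz
    rw [Metric.mem_ball, dist_eq_norm, hr, lt_min_iff, lt_min_iff] at hz
    simpa [Metric.mem_ball, dist_eq_norm] using hz
  have hQa : AnalyticOnNhd ℂ Q (Metric.ball p r) := fun z hz => hball z (hsub z hz).1
  have hf : IsSolutionOn Q (Metric.ball p r) (fun z => u₁ (z - p)) := by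
    refine isSolutionOn_of_punctured hQa (fun z hz => ?_) fun z hz hzp => ?_
    · exact AnalyticAt.fun_comp (h₁ _ (hsub z hz).2.1).2.1 (by fun_prop)
    · have e : deriv (fun z => u₁ (z - p)) = fun z => deriv u₁ (z - p) := by
        funext z; exact deriv_comp_sub_const _ _ _
      rw [e, deriv_comp_sub_const]
      have := (h₁ _ (hsub z hz).2.1).2.2
      rw [add_sub_cancel] at this
      apply mul_left_cancel₀ (pow_ne_zero 2 (sub_ne_zero.2 hzp))
      linear_combination this
  have hg : IsSolutionOn Q (Metric.ball p r) (fun z => (z - p) * u₂ (z - p)) := by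
    have ha : AnalyticOnNhd ℂ (fun z => (z - p) * u₂ (z - p)) (Metric.ball p r) := by
      intro z hz
      exact AnalyticAt.mul (by fun_prop)
        (AnalyticAt.fun_comp (h₂ _ (hsub z hz).2.2).2.1 (by fun_prop))
    refine isSolutionOn_of_punctured hQa ha fun z hz hzp => ?_
    have e : deriv (fun z => (z - p) * u₂ (z - p)) =
        fun z => deriv (fun x => x * u₂ x) (z - p) := by
      funext z; exact deriv_comp_sub_const (fun x => x * u₂ x) _ _
    have hz' := h₂ _ (hsub z hz).2.2
    have e1 : ∀ᶠ x in 𝓝 (z - p), deriv (fun x => x * u₂ x) x = u₂ x + x * deriv u₂ x := by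
      filter_upwards [hz'.2.1.eventually_analyticAt] with x hx
      refine (((hasDerivAt_id x).mul hx.differentiableAt.hasDerivAt).congr_deriv ?_).deriv
      simp
    rw [e, deriv_comp_sub_const, Filter.EventuallyEq.deriv_eq e1]
    have e2 : deriv (fun x => u₂ x + x * deriv u₂ x) (z - p) =
        2 * deriv u₂ (z - p) + (z - p) * deriv (deriv u₂) (z - p) := by
      refine ((hz'.2.1.differentiableAt.hasDerivAt.add ((hasDerivAt_id (z - p)).mul
        hz'.2.1.deriv.differentiableAt.hasDerivAt)).congr_deriv ?_).deriv
      simp only [id]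
      ring
    rw [e2]
    have := hz'.2.2
    rw [add_sub_cancel] at this
    apply mul_left_cancel₀ (sub_ne_zero.2 hzp)
    linear_combination this
  refine ⟨r, hr0, _, _, hf, hg, fun z hz => ?_⟩
  rw [hf.wronskian_eq Metric.isOpen_ball (convex_ball p r).isPreconnected hg hz
    (Metric.mem_ball_self hr0)]
  have hd : deriv (fun z => (z - p) * u₂ (z - p)) p = 1 := by
    have e : deriv (fun z => (z - p) * u₂ (z - p)) p = deriv (fun x => x * u₂ x) (p - p) :=
      deriv_comp_sub_const (fun x => x * u₂ x) _ _
    rw [e, sub_self]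
    have ha := (h₂ 0 (Metric.mem_ball_self hr₂)).2.1
    refine (((hasDerivAt_id (0 : ℂ)).mul ha.differentiableAt.hasDerivAt).congr_deriv ?_).deriv
    simp [hu₂]
  simp [wronskian, hd, hu₁]

theorem IsFrobeniusSolution.mono {Q y : ℂ → ℂ} {s Y Y' : ℝ} (h : IsFrobeniusSolution Q s Y y)
    (hY : Y ≤ Y') : IsFrobeniusSolution Q s Y' y := by
  obtain ⟨h1, c, hc0, hc⟩ := h
  exact ⟨h1.mono fun z hz => lt_of_le_of_lt hY hz, c, hc0, fun z hz => hc z (hY.trans_lt hz)⟩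

theorem norm_nome (z : ℂ) : ‖nome z‖ = Real.exp (-(2 * π * z.im)) := by
  rw [nome, Complex.norm_exp]
  congr 1
  simp

theorem tendsto_nome : Tendsto nome (comap Complex.im atTop) (𝓝 0) := by
  rw [tendsto_zero_iff_norm_tendsto_zero]
  simp only [norm_nome]
  refine (Real.tendsto_exp_neg_atTop_nhds_zero.comp
    (tendsto_id.const_mul_atTop (by positivity : (0 : ℝ) < 2 * π))).comp tendsto_comap

theorem hasDerivAt_nome (z : ℂ) : HasDerivAt nome (2 * π * I * nome z) z := by
  refine (((hasDerivAt_id z).const_mul (2 * π * I)).cexp).congr_deriv ?_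
  simp [nome, mul_comm]

theorem eventually_im_gt_iff {P : ℂ → Prop} :
    (∀ᶠ z in comap Complex.im atTop, P z) ↔ ∃ Y : ℝ, 0 ≤ Y ∧ ∀ z : ℂ, Y < z.im → P z := by
  rw [Filter.eventually_comap]
  constructor
  · intro h
    obtain ⟨Y, hY⟩ := Filter.eventually_atTop.1 h
    exact ⟨max Y 0, le_max_right _ _, fun z hz => hY z.im ((le_max_left _ _).trans hz.le) z rfl⟩
  · rintro ⟨Y, -, hY⟩
    filter_upwards [Filter.eventually_gt_atTop Y] with t ht z hz
    exact hY z (hz ▸ ht)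

theorem exists_isFrobeniusSolution {Q : ℂ → ℂ} {κ s δ : ℝ} (h : HasExponentsAtInfty Q κ)
    (hs : s ^ 2 = κ ^ 2) (hδ : 0 < δ) (hsδ : ∀ j : ℕ, 1 ≤ j → δ ≤ |(j : ℝ) ^ 2 + 2 * s * j|) :
    ∃ Y : ℝ, 0 ≤ Y ∧ ∃ y : ℂ → ℂ, IsFrobeniusSolution Q s Y y := by
  obtain ⟨-, g, hg, hg0, Y₀, hY₀⟩ := h
  have hs' : (s : ℂ) ^ 2 = (κ : ℂ) ^ 2 := by exact_mod_cast hs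
  have hpi : (π : ℂ) ≠ 0 := by exact_mod_cast Real.pi_ne_zero
  have hB : AnalyticAt ℂ (fun x => -(g x) / (4 * π ^ 2) - s ^ 2) 0 :=
    (hg.neg.div_const).sub analyticAt_const
  obtain ⟨r, hr, c, u, hc0, -, hu⟩ := exists_frobenius hB
    (by simp only [hg0, hs']; field_simp; ring) (2 * s) hδ (by
      intro j hj
      left
      have := hsδ j hj
      rw [← Real.norm_eq_abs, ← Complex.norm_real] at this
      push_cast at this
      exact this)
  have hev : ∀ᶠ z in comap Complex.im atTop, nome z ∈ Metric.ball (0 : ℂ) r :=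
    tendsto_nome.eventually (Metric.ball_mem_nhds 0 hr)
  obtain ⟨Y, hY, hball⟩ := eventually_im_gt_iff.1 (hev.and (eventually_im_gt_iff.2
    ⟨max Y₀ 0, le_max_right _ _, fun z hz => hY₀ z ((le_max_left _ _).trans_lt hz)⟩))
  have hopen : IsOpen {z : ℂ | Y < z.im} := isOpen_im_gt Y
  have hE : ∀ z : ℂ, HasDerivAt (fun z => exp (2 * π * I * s * z))
      (2 * π * I * s * exp (2 * π * I * s * z)) z := by
    intro z
    refine (((hasDerivAt_id z).const_mul (2 * π * I * s)).cexp).congr_deriv ?_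
    simp [mul_comm]
  have hN : ∀ z, AnalyticAt ℂ nome z := by
    intro z; unfold nome; fun_prop
  refine ⟨Y, hY, fun z => exp (2 * π * I * s * z) * u (nome z), ⟨fun z hz => ?_, fun z hz => ?_⟩,
    c, hc0, fun z hz => ?_⟩
  · have := (hu _ (hball z hz).1).2.1
    exact AnalyticAt.mul (by fun_prop) (AnalyticAt.fun_comp this (hN z))
  · have d1 : ∀ z : ℂ, Y < z.im → HasDerivAt (fun z => exp (2 * π * I * s * z) * u (nome z))
        (2 * π * I * exp (2 * π * I * s * z) * (s * u (nome z) + nome z * deriv u (nome z))) z := by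
      intro z hz
      have hu0 := (hu _ (hball z hz).1).2.1.differentiableAt.hasDerivAt.comp z (hasDerivAt_nome z)
      refine ((hE z).mul hu0).congr_deriv ?_
      simp only [Function.comp]
      ring
    have d1' : deriv (fun z => exp (2 * π * I * s * z) * u (nome z)) =ᶠ[𝓝 z] fun z =>
        2 * π * I * exp (2 * π * I * s * z) * (s * u (nome z) + nome z * deriv u (nome z)) := by
      filter_upwards [hopen.mem_nhds hz] with x hx using (d1 x hx).deriv
    rw [d1'.deriv_eq]
    have hu0 := (hu _ (hball z hz).1).2.1.differentiableAt.hasDerivAt.comp z (hasDerivAt_nome z)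
    have hu1 :=
      (hu _ (hball z hz).1).2.1.deriv.differentiableAt.hasDerivAt.comp z (hasDerivAt_nome z)
    have d2 := (((hE z).const_mul (2 * π * I)).mul ((hu0.const_mul (s : ℂ)).add
      ((hasDerivAt_nome z).mul hu1))).deriv
    refine d2.trans ?_
    have heq := (hu _ (hball z hz).1).2.2
    rw [(hball z hz).2]
    simp only [Function.comp, Pi.mul_apply, Pi.add_apply]
    field_simp at heq
    have hI : I ^ 2 = -1 := Complex.I_sq
    linear_combination (exp (2 * π * I * s * z) * I ^ 2) * heq
      - exp (2 * π * I * s * z) * g (nome z) * u (nome z) * hI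
  · have := (hu _ (hball z hz).1).1
    have e : exp (2 * π * I * s * z) * u (nome z) * exp (-(2 * π * I * s * z)) = u (nome z) := by
      rw [mul_right_comm, ← exp_add]; simp
    rw [e]
    exact this

/-- The two exponents `± n / 4` differ by the half-integer `n / 2`, so that neither of the two
Frobenius series at the cusp meets a resonance. -/
theorem exists_isFrobeniusSolution_pair {Q : ℂ → ℂ} {n : ℕ} (hn : Odd n)
    (h : HasExponentsAtInfty Q ((n : ℝ) / 4)) :
    ∃ Y : ℝ, 0 ≤ Y ∧ ∃ yminus yplus : ℂ → ℂ,
      IsFrobeniusSolution Q (-((n : ℝ) / 4)) Y yminus ∧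
      IsFrobeniusSolution Q ((n : ℝ) / 4) Y yplus := by
  have key : ∀ (k : ℤ), Odd k → ∀ j : ℕ, 1 ≤ j →
      (1 / 2 : ℝ) ≤ |(j : ℝ) ^ 2 + 2 * ((k : ℝ) / 4) * j| := by
    intro k hk j hj
    have e : (j : ℝ) ^ 2 + 2 * ((k : ℝ) / 4) * j = (j : ℝ) * ((2 * (j : ℤ) + k : ℤ) : ℝ) / 2 := by
      push_cast; ring
    have hne : (2 * (j : ℤ) + k) ≠ 0 := by
      obtain ⟨l, rfl⟩ := hk; omega
    have h1 : (1 : ℝ) ≤ |((2 * (j : ℤ) + k : ℤ) : ℝ)| := by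
      exact_mod_cast Int.one_le_abs hne
    have h2 : (1 : ℝ) ≤ j := by exact_mod_cast hj
    rw [e, abs_div, abs_mul, Nat.abs_cast, abs_two]
    nlinarith
  obtain ⟨Y₁, hY₁, y₁, h₁⟩ := exists_isFrobeniusSolution (s := -((n : ℝ) / 4)) h (by ring)
    (δ := 1 / 2) (by norm_num) (by
      intro j hj
      have := key (-n) (by simpa using hn) j hj
      push_cast at this
      rwa [neg_div] at this)
  obtain ⟨Y₂, hY₂, y₂, h₂⟩ := exists_isFrobeniusSolution (s := (n : ℝ) / 4) h rfl
    (δ := 1 / 2) (by norm_num) (by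
      intro j hj
      have := key n (by simpa using hn) j hj
      push_cast at this
      exact this)
  exact ⟨max Y₁ Y₂, le_max_of_le_left hY₁, y₁, y₂, h₁.mono (le_max_left _ _),
    h₂.mono (le_max_right _ _)⟩

/-! ### Extension of squares to discs -/

/-- Squares of germs of solutions at the regular points of `Metric.ball p r` extend to meromorphic
functions on that disc. -/
def ExtendsSquares (Q : ℂ → ℂ) (p : ℂ) (r : ℝ) : Prop :=
  ∀ z ∈ Metric.ball p r, AnalyticAt ℂ Q z → ∀ w : ℂ → ℂ, IsLocalSol Q w z →
    ∃ G : ℂ → ℂ, MeromorphicNFOn G (Metric.ball p r) ∧ G =ᶠ[𝓝 z] fun x => w x ^ 2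

theorem ExtendsSquares.mono {Q : ℂ → ℂ} {p p' : ℂ} {r r' : ℝ} (h : ExtendsSquares Q p r)
    (hsub : Metric.ball p' r' ⊆ Metric.ball p r) : ExtendsSquares Q p' r' := by
  intro z hz hQ w hw
  obtain ⟨G, hG, hGw⟩ := h z (hsub hz) hQ w hw
  exact ⟨G, fun x hx => hG (hsub hx), hGw⟩

theorem exists_extendsSquares_of_analyticAt {Q : ℂ → ℂ} {p : ℂ} (hQ : AnalyticAt ℂ Q p) :
    ∃ r : ℝ, 0 < r ∧ ExtendsSquares Q p r := by
  obtain ⟨r, hr, f, g, hf, hg, hW⟩ := exists_local_basis hQ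
  refine ⟨r, hr, fun z hz _ w hw => ?_⟩
  obtain ⟨a, b, hab⟩ := (hf.isLocalSol Metric.isOpen_ball hz).exists_eq_combination
    (hg.isLocalSol Metric.isOpen_ball hz) hw (hW z hz)
  refine ⟨fun x => (a * f x + b * g x) ^ 2, fun x hx => ?_, ?_⟩
  · exact (((analyticAt_const.mul (hf.1 x hx)).add
      (analyticAt_const.mul (hg.1 x hx))).pow 2).meromorphicNFAt
  · filter_upwards [hab] with x hx
    rw [hx]

theorem exists_meromorphicNFOn_eventuallyEq {f : ℂ → ℂ} {U : Set ℂ} (hf : MeromorphicOn f U) :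
    ∃ g : ℂ → ℂ, MeromorphicNFOn g U ∧ ∀ z ∈ U, g =ᶠ[𝓝[≠] z] f :=
  ⟨toMeromorphicNFOn f U, meromorphicNFOn_toMeromorphicNFOn f U,
    fun _ hz => hf.toMeromorphicNFOn_eq_self_on_nhdsNE hz⟩

theorem eventuallyEq_nhds_of_meromorphicNFAt {f g : ℂ → ℂ} {z : ℂ} (hf : MeromorphicNFAt f z)
    (hg : MeromorphicNFAt g z) (h : f =ᶠ[𝓝[≠] z] g) : f =ᶠ[𝓝 z] g :=
  (hf.eventuallyEq_nhdsNE_iff_eventuallyEq_nhds hg).1 h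

/-- At an apparent singularity with exponents `1/2 ± m/2`, a solution is `(z - p) ^ ((1 - m)/2) h`
with `h` holomorphic, so that its square `(z - p) ^ (1 - m) h ^ 2` is single-valued. -/
theorem exists_extendsSquares_of_noLogAt {Q : ℂ → ℂ} {p : ℂ} (hp : IsPole Q p) {κ : ℝ} {m : ℕ}
    (hκ : κ = m / 2) (h : NoLogAt Q p κ) : ∃ r : ℝ, 0 < r ∧ ExtendsSquares Q p r := by
  obtain ⟨r, hr, hlog⟩ := h
  refine ⟨r, hr, fun z₁ hz₁ hQ w hw => ?_⟩
  have hne : z₁ ≠ p := by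
    rintro rfl
    exact absurd hQ.meromorphicOrderAt_nonneg (not_le.2 hp)
  have hpos : 0 < dist z₁ p := dist_pos.2 hne
  obtain ⟨s, ⟨hsol, hs1⟩, hs2⟩ := ((hw.exists_ball.and
    (Ioo_mem_nhdsGT (lt_min hpos (sub_pos.2 (Metric.mem_ball.1 hz₁))))).and
    self_mem_nhdsWithin).exists
  have hs2 : 0 < s := hs2
  have hs3 := (hs1.2.trans_le (min_le_left _ _)).le
  have hs4 := (hs1.2.trans_le (min_le_right _ _)).le
  have hzp : z₁ - p ≠ 0 := sub_ne_zero.2 hne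
  have hslit : ∀ z ∈ Metric.ball z₁ s, (z - p) / (z₁ - p) ∈ slitPlane := by
    intro z hz
    have : ‖(z - p) / (z₁ - p) - 1‖ < 1 := by
      rw [div_sub_one hzp, norm_div, div_lt_one (norm_pos_iff.2 hzp), sub_sub_sub_cancel_right,
        ← dist_eq_norm, ← dist_eq_norm]
      exact (Metric.mem_ball.1 hz).trans_le hs3
    simpa using Complex.mem_slitPlane_of_norm_lt_one this
  have hzne : ∀ z ∈ Metric.ball z₁ s, z - p ≠ 0 := fun z hz h0 => by
    have := hslit z hz
    simp [h0] at this
  obtain ⟨h, hh, hwh⟩ := hlog (Metric.ball z₁ s) Metric.isOpen_ball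
    (convex_ball z₁ s).isPreconnected
    (fun z hz => ⟨Metric.mem_ball.2 (by
      have := dist_triangle z z₁ p
      have := Metric.mem_ball.1 hz
      linarith), fun h0 => hzne z hz (sub_eq_zero.2 h0)⟩)
    (fun z => log ((z - p) / (z₁ - p)) + log (z₁ - p))
    (fun z hz => AnalyticAt.add
      (AnalyticAt.clog (by fun_prop (disch := exact hzp)) (hslit z hz)) analyticAt_const)
    (fun z hz => by
      rw [exp_add, exp_log (slitPlane_ne_zero (hslit z hz)), exp_log hzp, div_mul_cancel₀ _ hzp])
    w hsol
  have hmer : MeromorphicOn (fun z => (z - p) ^ (1 - m : ℤ) * h z ^ 2) (Metric.ball p r) := by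
    intro z hz
    exact ((MeromorphicAt.id z).sub (MeromorphicAt.const p z)).zpow _ |>.mul
      ((hh z hz).meromorphicAt.pow 2)
  obtain ⟨G, hG, hGe⟩ := exists_meromorphicNFOn_eventuallyEq hmer
  refine ⟨G, hG, eventuallyEq_nhds_of_meromorphicNFAt (hG hz₁) (hw.1.pow 2).meromorphicNFAt ?_⟩
  filter_upwards [hGe z₁ hz₁, nhdsWithin_le_nhds (Metric.ball_mem_nhds z₁ hs2)] with z h1 h2
  rw [h1, hwh z h2, mul_pow, ← exp_nat_mul]
  congr 1
  have e : (2 : ℕ) * ((1 / 2 - (κ : ℂ)) * (log ((z - p) / (z₁ - p)) + log (z₁ - p)))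
      = ((1 - m : ℤ) : ℂ) * (log ((z - p) / (z₁ - p)) + log (z₁ - p)) := by
    rw [hκ]; push_cast; ring
  rw [e, exp_int_mul, exp_add, exp_log (slitPlane_ne_zero (hslit z h2)), exp_log hzp,
    div_mul_cancel₀ _ hzp]

theorem IsLocalSol.comp_add_const {Q w : ℂ → ℂ} {z k : ℂ} (hw : IsLocalSol Q w (z + k))
    (hk : ∀ᶠ x in 𝓝 z, Q (x + k) = Q x) : IsLocalSol Q (fun x => w (x + k)) z := by
  refine ⟨AnalyticAt.fun_comp hw.1 (by fun_prop), ?_⟩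
  have e : deriv (fun x => w (x + k)) = fun x => deriv w (x + k) := by
    funext x; exact deriv_comp_add_const _ _ _
  have ht : Tendsto (fun x => x + k) (𝓝 z) (𝓝 (z + k)) :=
    (continuous_add_const k).tendsto z
  filter_upwards [ht.eventually hw.2, hk] with x h1 h2
  rw [e, deriv_comp_add_const, h1, h2]

theorem mem_H {z : ℂ} : z ∈ H ↔ 0 < z.im := Iff.rfl

theorem isOpen_H : IsOpen H := isOpen_im_gt 0

theorem isPreconnected_H : IsPreconnected H := (convex_halfSpace_im_gt 0).isPreconnected

theorem ExtendsSquares.translate {Q : ℂ → ℂ} (hT : ∀ (k : ℤ), ∀ z ∈ H, Q (z + k) = Q z) {p : ℂ}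
    {r : ℝ} (hsub : Metric.ball p r ⊆ H) (h : ExtendsSquares Q p r) (k : ℤ) :
    ExtendsSquares Q (p + k) r := by
  intro z hz hQ w hw
  have hz' : z - k ∈ Metric.ball p r := by
    rw [Metric.mem_ball, dist_eq_norm] at hz ⊢
    rwa [sub_sub, add_comm (k : ℂ) p]
  have hper : ∀ᶠ x in 𝓝 (z - k), Q (x + k) = Q x := by
    filter_upwards [isOpen_H.mem_nhds (hsub hz')] with x hx using hT k x hx
  have hQ' : AnalyticAt ℂ Q (z - k) := by
    refine AnalyticAt.congr (f := fun x => Q (x + k)) ?_ hper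
    exact AnalyticAt.fun_comp (by simpa using hQ) (by fun_prop)
  obtain ⟨G, hG, hGw⟩ := h _ hz' hQ' (fun x => w (x + k))
    (IsLocalSol.comp_add_const (by simpa using hw) hper)
  refine ⟨fun x => G (x - k), fun x hx => ?_, ?_⟩
  · apply meromorphicNFAt_comp_sub_const_iff_meromorphicNFAt.2
    apply hG
    rw [Metric.mem_ball, dist_eq_norm] at hx ⊢
    rwa [sub_sub, add_comm (k : ℂ) p]
  · have ht : Tendsto (fun x : ℂ => x - k) (𝓝 z) (𝓝 (z - k)) :=
      (continuous_id.sub continuous_const).tendsto z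
    filter_upwards [ht.eventually hGw] with x hx
    simpa using hx

/-! ### Extension of squares to the upper half-plane -/

/-- By periodicity, the discs of extension may be taken of the same radius along a horizontal
line. -/
theorem exists_uniform_extendsSquares {Q : ℂ → ℂ} (hT : ∀ (k : ℤ), ∀ z ∈ H, Q (z + k) = Q z)
    (hext : ∀ p ∈ H, ∃ r : ℝ, 0 < r ∧ ExtendsSquares Q p r) {t : ℝ} (ht : 0 < t) :
    ∃ ε : ℝ, 0 < ε ∧ ∀ x : ℝ, ExtendsSquares Q (x + t * I) ε := by
  let K : Set ℂ := (fun x : ℝ => (x : ℂ) + t * I) '' Set.Icc 0 1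
  have hK : IsCompact K := isCompact_Icc.image (by fun_prop)
  have hKH : ∀ z ∈ K, z ∈ H := by
    rintro _ ⟨x, -, rfl⟩
    simpa [mem_H] using ht
  choose r hr hrext using hext
  obtain ⟨δ, hδ, hcov⟩ := lebesgue_number_lemma_of_metric (c := fun p : H => Metric.ball p.1
    (r p.1 p.2)) hK (fun p => Metric.isOpen_ball)
    (fun z hz => Set.mem_iUnion.2 ⟨⟨z, hKH z hz⟩, Metric.mem_ball_self (hr _ _)⟩)
  refine ⟨min δ t, lt_min hδ ht, fun x => ?_⟩
  have hfr : ((Int.fract x : ℝ) : ℂ) + t * I ∈ K :=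
    ⟨Int.fract x, ⟨Int.fract_nonneg x, (Int.fract_lt_one x).le⟩, rfl⟩
  obtain ⟨p, hp⟩ := hcov _ hfr
  have h1 : ExtendsSquares Q ((Int.fract x : ℝ) + t * I) (min δ t) :=
    (hrext p.1 p.2).mono ((Metric.ball_subset_ball (min_le_left _ _)).trans hp)
  have h2 := h1.translate hT (fun z hz => by
    have h3 := (Complex.abs_im_le_norm (z - ((Int.fract x : ℝ) + t * I))).trans_lt
      ((mem_ball_iff_norm.1 hz).trans_le (min_le_right _ _))
    rw [abs_lt] at h3
    have := h3.1
    simp at this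
    exact this) ⌊x⌋
  convert h2 using 1
  rw [add_right_comm]
  congr 1
  exact_mod_cast (Int.fract_add_floor x).symm

theorem exists_mem_analyticAt {Q : ℂ → ℂ} {V : Set ℂ} (hV : IsOpen V) (hne : V.Nonempty)
    (hQ : MeromorphicOn Q V) : ∃ z ∈ V, AnalyticAt ℂ Q z := by
  obtain ⟨z, hz⟩ := hne
  obtain ⟨x, h1, h2⟩ := ((hQ z hz).eventually_analyticAt.and
    (nhdsWithin_le_nhds (hV.mem_nhds hz))).exists
  exact ⟨x, h2, h1⟩

theorem SquareEq.congr {Q G G' : ℂ → ℂ} {z : ℂ} (h : SquareEq Q G z) (hG : G' =ᶠ[𝓝[≠] z] G) :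
    SquareEq Q G' z := by
  filter_upwards [h, hG, hG.nhdsNE_deriv, hG.nhdsNE_deriv.nhdsNE_deriv] with x h0 h1 h2 h3
  rw [h1, h2, h3, h0]

theorem exists_mem_im_gt {V : Set ℂ} (hV : IsOpen V) {m : ℂ} (hm : m ∈ V) :
    ∃ z ∈ V, m.im < z.im := by
  have hc : ContinuousAt (fun a : ℝ => m + a * I) 0 := by fun_prop
  have h0 : V ∈ 𝓝 (m + (0 : ℝ) * I) := by simpa using hV.mem_nhds hm
  obtain ⟨a, h1, h2⟩ := (((hc.eventually h0).filter_mono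
    (nhdsWithin_le_nhds (s := Set.Ioi 0))).and self_mem_nhdsWithin).exists
  exact ⟨_, h1, by simpa using h2⟩

/-- The extension of the square of a solution across a horizontal line: on each disc centred on the
line it is determined by its values above the line. -/
theorem exists_extension_below {Q : ℂ → ℂ} (hQ : MeromorphicOn Q H) {s ε : ℝ} (hs : 0 < s)
    (hε : 0 < ε) (hext : ∀ x : ℝ, ExtendsSquares Q (x + s * I) ε) {G : ℂ → ℂ}
    (hG : MeromorphicNFOn G {z | s < z.im}) (hsq : ∀ z : ℂ, s < z.im → SquareEq Q G z) :
    ∃ G' : ℂ → ℂ, MeromorphicNFOn G' {z | s - ε < z.im} ∧ ∀ z : ℂ, s < z.im → G' z = G z := by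
  have hdisc : ∀ x : ℝ, ∃ g : ℂ → ℂ, MeromorphicNFOn g (Metric.ball (x + s * I) ε) ∧
      ∀ z ∈ Metric.ball (x + s * I : ℂ) ε, s < z.im → g z = G z := by
    intro x
    have hVo : IsOpen (Metric.ball (x + s * I : ℂ) ε ∩ {z | s < z.im}) :=
      Metric.isOpen_ball.inter (isOpen_im_gt s)
    obtain ⟨m, hm, hms⟩ := exists_mem_im_gt Metric.isOpen_ball
      (Metric.mem_ball_self (x := (x + s * I : ℂ)) hε)
    obtain ⟨z₁, hz₁, hQz₁⟩ := exists_mem_analyticAt hVo ⟨m, hm, by simpa using hms⟩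
      (fun z hz => hQ z (hs.trans hz.2))
    obtain ⟨w, hw, hGw⟩ := (hsq z₁ hz₁.2).exists_isLocalSol hQz₁ (hG hz₁.2)
    obtain ⟨g, hg, hgw⟩ := hext x z₁ hz₁.1 hQz₁ w hw
    refine ⟨g, hg, fun z hz hzs => ?_⟩
    exact eqOn_of_meromorphicNFOn
      ((convex_ball _ _).inter (convex_halfSpace_im_gt s)).isPreconnected
      (fun y hy => hg hy.1) (fun y hy => hG hy.2) hz₁
      ((hgw.trans hGw.symm).filter_mono nhdsWithin_le_nhds) ⟨hz, hzs⟩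
  choose g hg hgG using hdisc
  let G' : ℂ → ℂ := fun z => if s < z.im then G z else g z.re z
  have hself : ∀ z : ℂ, s - ε < z.im → z.im ≤ s →
      z ∈ Metric.ball ((z.re : ℂ) + s * I) ε := by
    intro z h1 h2
    have : z - (z.re + s * I) = ((z.im - s : ℝ) : ℂ) * I := by
      apply Complex.ext <;> simp
    rw [mem_ball_iff_norm, this, norm_mul, Complex.norm_I, mul_one, Complex.norm_real,
      Real.norm_eq_abs, abs_lt]
    constructor <;> linarith
  have hagree : ∀ (x : ℝ) (z : ℂ), z ∈ Metric.ball (x + s * I : ℂ) ε → s - ε < z.im →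
      G' z = g x z := by
    intro x z hz hz'
    by_cases hzs : s < z.im
    · simp only [G', if_pos hzs]
      exact (hgG x z hz hzs).symm
    · simp only [G', if_neg hzs]
      set V : Set ℂ := Metric.ball (z.re + s * I : ℂ) ε ∩ Metric.ball (x + s * I : ℂ) ε with hV
      have hVo : IsOpen V := Metric.isOpen_ball.inter Metric.isOpen_ball
      have hm : (z.re + s * I : ℂ) ∈ V := by
        refine ⟨Metric.mem_ball_self hε, ?_⟩
        have h1 := (Complex.abs_re_le_norm _).trans_lt (mem_ball_iff_norm.1 hz)
        have h2 : (z.re + s * I : ℂ) - (x + s * I) = ((z.re - x : ℝ) : ℂ) := by push_cast; ring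
        rw [mem_ball_iff_norm, h2, Complex.norm_real, Real.norm_eq_abs]
        simpa using h1
      obtain ⟨z₁, hz₁, hz₁s⟩ := exists_mem_im_gt hVo hm
      have hz₁s : s < z₁.im := by simpa using hz₁s
      refine eqOn_of_meromorphicNFOn (U := V) ((convex_ball _ _).inter
        (convex_ball _ _)).isPreconnected (fun y hy => hg _ hy.1) (fun y hy => hg _ hy.2) hz₁ ?_
        ⟨hself z hz' (not_lt.1 hzs), hz⟩
      refine Filter.EventuallyEq.filter_mono ?_ nhdsWithin_le_nhds
      filter_upwards [hVo.mem_nhds hz₁, (isOpen_im_gt s).mem_nhds hz₁s] with y h1 h2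
      rw [hgG _ y h1.1 h2, hgG _ y h1.2 h2]
  refine ⟨G', fun z hz => ?_, fun z hz => by simp only [G', if_pos hz]⟩
  have hz : s - ε < z.im := hz
  by_cases hzs : s < z.im
  · refine (meromorphicNFAt_congr ?_).1 (hG hzs)
    filter_upwards [(isOpen_im_gt s).mem_nhds hzs] with y hy
    have hy : s < y.im := hy
    simp only [G', if_pos hy]
  · have hzb := hself z hz (not_lt.1 hzs)
    refine (meromorphicNFAt_congr ?_).1 (hg z.re hzb)
    filter_upwards [Metric.isOpen_ball.mem_nhds hzb, (isOpen_im_gt (s - ε)).mem_nhds hz]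
      with y h1 h2
    exact (hagree _ y h1 h2).symm

/-- Squares of solutions on `Im z > Y` extend to the upper half-plane: a lowest half-plane of
extension exists, and its boundary line can be crossed. -/
theorem exists_extension {Q : ℂ → ℂ} (hQ : MeromorphicOn Q H)
    (hT : ∀ (k : ℤ), ∀ z ∈ H, Q (z + k) = Q z)
    (hext : ∀ p ∈ H, ∃ r : ℝ, 0 < r ∧ ExtendsSquares Q p r) {Y : ℝ} (hY : 0 ≤ Y) {G₀ : ℂ → ℂ}
    (hG₀ : MeromorphicNFOn G₀ {z | Y < z.im}) (hsq : ∀ z : ℂ, Y < z.im → SquareEq Q G₀ z) :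
    ∃ G : ℂ → ℂ, MeromorphicNFOn G H ∧ ∀ z : ℂ, Y < z.im → G z = G₀ z := by
  let S : Set ℝ := {t | (0 ≤ t ∧ t ≤ Y) ∧ ∃ G : ℂ → ℂ, MeromorphicNFOn G {z | t < z.im} ∧
    ∀ z : ℂ, Y < z.im → G z = G₀ z}
  have hYS : Y ∈ S := ⟨⟨hY, le_rfl⟩, G₀, hG₀, fun _ _ => rfl⟩
  have hbdd : BddBelow S := ⟨0, fun t ht => ht.1.1⟩
  set s := sInf S with hs
  have hs0 : 0 ≤ s := le_csInf ⟨Y, hYS⟩ fun t ht => ht.1.1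
  have hsY : s ≤ Y := csInf_le hbdd hYS
  have htop : ∃ z₁ : ℂ, Y < z₁.im := ⟨((Y + 1 : ℝ) : ℂ) * I, by simp⟩
  obtain ⟨z₁, hz₁⟩ := htop
  have huniq : ∀ {t t' : ℝ} {G G' : ℂ → ℂ}, t ≤ Y → t' ≤ Y →
      MeromorphicNFOn G {z | t < z.im} → MeromorphicNFOn G' {z | t' < z.im} →
      (∀ z : ℂ, Y < z.im → G z = G₀ z) → (∀ z : ℂ, Y < z.im → G' z = G₀ z) →
      ∀ z : ℂ, t < z.im → t' < z.im → G z = G' z := by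
    intro t t' G G' ht ht' hG hG' h h' z hz hz'
    refine eqOn_of_meromorphicNFOn
      ((convex_halfSpace_im_gt t).inter (convex_halfSpace_im_gt t')).isPreconnected
      (fun y hy => hG hy.1) (fun y hy => hG' hy.2)
      (show z₁ ∈ {z : ℂ | t < z.im} ∩ {z : ℂ | t' < z.im} from
        ⟨ht.trans_lt hz₁, ht'.trans_lt hz₁⟩) ?_ ⟨hz, hz'⟩
    refine Filter.EventuallyEq.filter_mono ?_ nhdsWithin_le_nhds
    filter_upwards [(isOpen_im_gt Y).mem_nhds hz₁] with y hy
    rw [h y hy, h' y hy]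
  -- the infimum is attained
  have hsS : ∃ G : ℂ → ℂ, MeromorphicNFOn G {z | s < z.im} ∧ ∀ z : ℂ, Y < z.im → G z = G₀ z := by
    have hex : ∀ z : ℂ, ∃ t : ℝ, ∃ g : ℂ → ℂ, s < z.im → (t < z.im ∧ t ≤ Y ∧
        MeromorphicNFOn g {z | t < z.im} ∧ ∀ z : ℂ, Y < z.im → g z = G₀ z) := by
      intro z
      by_cases hz : s < z.im
      · obtain ⟨t, ⟨⟨-, ht⟩, g, hg, hg'⟩, htz⟩ := exists_lt_of_csInf_lt ⟨Y, hYS⟩ hz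
        exact ⟨t, g, fun _ => ⟨htz, ht, hg, hg'⟩⟩
      · exact ⟨0, 0, fun h => absurd h hz⟩
    choose t g hg using hex
    refine ⟨fun z => g z z, fun z hz => ?_, fun z hz => (hg z (hsY.trans_lt hz)).2.2.2 z hz⟩
    obtain ⟨h1, h2, h3, h4⟩ := hg z hz
    refine (meromorphicNFAt_congr ?_).1 (h3 h1)
    filter_upwards [(isOpen_im_gt s).mem_nhds hz, (isOpen_im_gt (t z)).mem_nhds h1] with y hy hy'
    obtain ⟨k1, k2, k3, k4⟩ := hg y hy
    exact huniq h2 k2 h3 k3 h4 k4 y hy' k1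
  obtain ⟨G, hG, hGG⟩ := hsS
  rcases hs0.eq_or_lt with h0 | hpos
  · rw [← h0] at hG
    exact ⟨G, hG, hGG⟩
  exfalso
  have hGsq : ∀ z : ℂ, s < z.im → SquareEq Q G z := by
    intro z hz
    refine SquareEq.of_isPreconnected (convex_halfSpace_im_gt s).isPreconnected
      (fun y hy => hQ y (hpos.trans hy)) hG.meromorphicOn
      (show z₁ ∈ {z : ℂ | s < z.im} from hsY.trans_lt hz₁) hz ((hsq z₁ hz₁).congr ?_)
    refine Filter.EventuallyEq.filter_mono ?_ nhdsWithin_le_nhds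
    filter_upwards [(isOpen_im_gt Y).mem_nhds hz₁] with y hy using hGG y hy
  obtain ⟨ε, hε, hεext⟩ := exists_uniform_extendsSquares hT hext hpos
  obtain ⟨G', hG', hGG'⟩ := exists_extension_below hQ hpos hε hεext hG hGsq
  have hlt : max 0 (s - ε) < s := max_lt hpos (by linarith)
  have hmem : max 0 (s - ε) ∈ S :=
    ⟨⟨le_max_left _ _, hlt.le.trans hsY⟩, G',
      fun z hz => hG' (show s - ε < z.im from (le_max_right _ _).trans_lt hz),
      fun z hz => (hGG' z (hsY.trans_lt hz)).trans (hGG z hz)⟩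
  exact absurd (csInf_le hbdd hmem) (not_le.2 hlt)

theorem exists_isSquareOfContinuation {Q : ℂ → ℂ} (hQ : MeromorphicNFOn Q H)
    (hT : ∀ (k : ℤ), ∀ z ∈ H, Q (z + k) = Q z)
    (hext : ∀ p ∈ H, ∃ r : ℝ, 0 < r ∧ ExtendsSquares Q p r) {Y : ℝ} (hY : 0 ≤ Y) {y : ℂ → ℂ}
    (hy : IsSolutionOn Q {z | Y < z.im} y) :
    ∃ G : ℂ → ℂ, IsSquareOfContinuation Q Y y G := by
  obtain ⟨G, hG, hGG⟩ := exists_extension hQ.meromorphicOn hT hext hY (G₀ := fun z => y z ^ 2)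
    (fun z hz => ((hy.1 z hz).pow 2).meromorphicNFAt)
    (fun z hz => (hy.isLocalSol (isOpen_im_gt Y) hz).squareEq (by rfl))
  obtain ⟨z₁, hz₁⟩ : ∃ z₁ : ℂ, Y < z₁.im := ⟨((Y + 1 : ℝ) : ℂ) * I, by simp⟩
  have hsq : ∀ z ∈ H, SquareEq Q G z := by
    intro z hz
    refine SquareEq.of_isPreconnected isPreconnected_H hQ.meromorphicOn hG.meromorphicOn
      (show z₁ ∈ H from hY.trans_lt hz₁) hz
      ((hy.isLocalSol (isOpen_im_gt Y) hz₁).squareEq ?_)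
    refine Filter.EventuallyEq.filter_mono ?_ nhdsWithin_le_nhds
    filter_upwards [(isOpen_im_gt Y).mem_nhds hz₁] with y hy using hGG y hy
  refine ⟨G, hG, hGG, fun z₀ hz₀ hQz₀ => ?_⟩
  obtain ⟨w, hw, hGw⟩ := (hsq z₀ hz₀).exists_isLocalSol hQz₀ (hG hz₀)
  obtain ⟨r, hr, hball⟩ := Metric.eventually_nhds_iff_ball.1 hGw
  obtain ⟨s, hs, hs'⟩ := (hw.exists_ball.and (Ioo_mem_nhdsGT hr)).exists
  exact ⟨Metric.ball z₀ s, Metric.isOpen_ball, Metric.mem_ball_self hs'.1, w, hs,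
    fun z hz => hball z (Metric.ball_subset_ball hs'.2.le hz)⟩

theorem ne_zero_of_mem_H {z : ℂ} (hz : z ∈ H) : z ≠ 0 := by
  rintro rfl
  simp [mem_H] at hz

theorem neg_one_div_mem_H {z : ℂ} (hz : z ∈ H) : -1 / z ∈ H := by
  have h0 : 0 < normSq z := normSq_pos.2 (ne_zero_of_mem_H hz)
  rw [mem_H, neg_div, one_div, Complex.neg_im, Complex.inv_im, neg_div, neg_neg]
  exact div_pos hz h0

/-! ### The operations of `S` and `T` -/

theorem onH_slash_S_apply (f : ℂ → ℂ) (k : ℤ) (τ : ℍ) :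
    (onH f ∣[k] ModularGroup.S) τ = f (-1 / τ) * (τ : ℂ) ^ (-k) := by
  rw [ModularForm.SL_slash_apply, ModularGroup.denom_S, UpperHalfPlane.modular_S_smul]
  simp [onH, neg_div, inv_neg]

theorem onH_slash_T_zpow_apply (f : ℂ → ℂ) (k m : ℤ) (τ : ℍ) :
    (onH f ∣[k] (ModularGroup.T ^ m)) τ = f (τ + m) := by
  rw [ModularForm.SL_slash_apply, UpperHalfPlane.modular_T_zpow_smul]
  simp [onH, ModularGroup.denom_apply, ModularGroup.coe_T_zpow, add_comm, -map_zpow]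

theorem onH_slash_T_apply (f : ℂ → ℂ) (k : ℤ) (τ : ℍ) :
    (onH f ∣[k] ModularGroup.T) τ = f (τ + 1) := by
  simpa using onH_slash_T_zpow_apply f k 1 τ

theorem IsMeromorphicModularForm.apply_add_intCast {k : ℤ} {f : ℂ → ℂ}
    (hf : IsMeromorphicModularForm k f) (m : ℤ) : ∀ z ∈ H, f (z + m) = f z := by
  intro z hz
  have := congrFun (hf.slash_eq (ModularGroup.T ^ m)) ⟨z, hz⟩
  rw [onH_slash_T_zpow_apply] at this
  exact this

theorem IsMeromorphicModularForm.apply_neg_one_div {k : ℤ} {f : ℂ → ℂ}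
    (hf : IsMeromorphicModularForm k f) : ∀ z ∈ H, f (-1 / z) = z ^ k * f z := by
  intro z hz
  have := congrFun (hf.slash_eq ModularGroup.S) ⟨z, hz⟩
  rw [onH_slash_S_apply, zpow_neg] at this
  have h0 : z ^ k ≠ 0 := zpow_ne_zero _ (ne_zero_of_mem_H hz)
  have h1 : f (-1 / z) * (z ^ k)⁻¹ = f z := this
  rw [← h1]
  field_simp

theorem hasDerivAt_neg_one_div {z : ℂ} (hz : z ≠ 0) :
    HasDerivAt (fun x : ℂ => -1 / x) (1 / z ^ 2) z := by
  refine ((hasDerivAt_inv hz).const_mul (-1)).congr_deriv ?_ |>.congr_of_eventuallyEq ?_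
  · simp
  · exact Filter.Eventually.of_forall fun x => by simp [div_eq_mul_inv]

theorem analyticAt_neg_one_div {z : ℂ} (hz : z ≠ 0) : AnalyticAt ℂ (fun x : ℂ => -1 / x) z :=
  analyticAt_const.div analyticAt_id hz

/-- The slash operation of weight `-1` by `S` preserves solutions of `y'' = Q y` (Bol's
lemma). The derivative at `z₀` is what the comparison of Wronskians needs. -/
theorem IsLocalSol.slash_S {Q : ℂ → ℂ} (hQ : ∀ z ∈ H, Q (-1 / z) = z ^ (4 : ℤ) * Q z) {z₀ : ℂ}
    (hz₀ : z₀ ∈ H) {w : ℂ → ℂ} (hw : IsLocalSol Q w (-1 / z₀)) :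
    IsLocalSol Q (fun z => z * w (-1 / z)) z₀ ∧
      deriv (fun z => z * w (-1 / z)) z₀ = w (-1 / z₀) + deriv w (-1 / z₀) / z₀ := by
  have hne := ne_zero_of_mem_H hz₀
  have hcont : Tendsto (fun x : ℂ => -1 / x) (𝓝 z₀) (𝓝 (-1 / z₀)) :=
    (analyticAt_neg_one_div hne).continuousAt
  have hna : ∀ᶠ z in 𝓝 z₀, AnalyticAt ℂ w (-1 / z) ∧ z ∈ H :=
    (hcont.eventually hw.1.eventually_analyticAt).and (isOpen_H.mem_nhds hz₀)
  have d1 : ∀ᶠ z in 𝓝 z₀, deriv (fun z => z * w (-1 / z)) z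
      = w (-1 / z) + deriv w (-1 / z) / z := by
    filter_upwards [hna] with z hz
    have h0 := ne_zero_of_mem_H hz.2
    have hc := hz.1.differentiableAt.hasDerivAt.comp z (hasDerivAt_neg_one_div h0)
    refine (((hasDerivAt_id z).mul hc).congr_deriv ?_).deriv
    simp only [Function.comp, id]
    field_simp
  refine ⟨⟨analyticAt_id.mul (AnalyticAt.fun_comp hw.1 (analyticAt_neg_one_div hne)), ?_⟩,
    d1.self_of_nhds⟩
  filter_upwards [d1.eventually_nhds, hna, hcont.eventually hw.2] with z h1 hz h2
  have h0 := ne_zero_of_mem_H hz.2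
  rw [Filter.EventuallyEq.deriv_eq h1]
  have hc := hz.1.differentiableAt.hasDerivAt.comp z (hasDerivAt_neg_one_div h0)
  have hc1 := hz.1.deriv.differentiableAt.hasDerivAt.comp z (hasDerivAt_neg_one_div h0)
  refine ((hc.add (hc1.mul (hasDerivAt_inv h0))).congr_deriv ?_).deriv
  rw [h2, hQ z hz.2]
  simp only [Function.comp]
  field_simp
  ring

theorem wronskian_slash_S {Q : ℂ → ℂ} (hQ : ∀ z ∈ H, Q (-1 / z) = z ^ (4 : ℤ) * Q z) {z₀ : ℂ}
    (hz₀ : z₀ ∈ H) {f g : ℂ → ℂ} (hf : IsLocalSol Q f (-1 / z₀)) (hg : IsLocalSol Q g (-1 / z₀)) :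
    wronskian (fun z => z * f (-1 / z)) (fun z => z * g (-1 / z)) z₀
      = wronskian f g (-1 / z₀) := by
  have hne := ne_zero_of_mem_H hz₀
  simp only [wronskian, (hf.slash_S hQ hz₀).2, (hg.slash_S hQ hz₀).2]
  field_simp
  ring

/-! ### Local analysis at the elliptic points -/

/-- Comparison of leading coefficients in a functional equation at a fixed point `p` of `φ`. -/
theorem sq_mul_zpow_eq_of_fixed_point {G φ : ℂ → ℂ} {p α μ : ℂ} {m : ℤ} (hG : MeromorphicAt G p)
    (hm : meromorphicOrderAt G p = m) (hφ : HasDerivAt φ α p) (hp : φ p = p)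
    (hα : α ≠ 0) (h : ∀ᶠ z in 𝓝[≠] p, z ^ 2 * G (φ z) = μ * G z) : p ^ 2 * α ^ m = μ := by
  obtain ⟨g, hg, hgp, hGg⟩ := (meromorphicOrderAt_eq_int_iff hG).1 hm
  have hφt : Tendsto φ (𝓝[≠] p) (𝓝[≠] p) := by
    have := hφ.tendsto_nhdsNE hα
    rwa [hp] at this
  have hslope : Tendsto (fun z => (φ z - p) / (z - p)) (𝓝[≠] p) (𝓝 α) := by
    have := hasDerivAt_iff_tendsto_slope.1 hφ
    refine this.congr fun z => ?_
    rw [slope_def_field, hp]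
  have cg := hg.continuousAt.tendsto.mono_left (nhdsWithin_le_nhds (s := {p}ᶜ))
  have cid : Tendsto (fun z : ℂ => z) (𝓝[≠] p) (𝓝 p) := nhdsWithin_le_nhds
  have L := ((cid.pow 2).mul (hslope.zpow₀ m (Or.inl hα))).mul (cg.comp hφt)
  have R := cg.const_mul μ
  have key : ∀ᶠ z in 𝓝[≠] p, z ^ 2 * ((φ z - p) / (z - p)) ^ m * (g ∘ φ) z = μ * g z := by
    filter_upwards [h, hGg, hφt.eventually hGg, self_mem_nhdsWithin] with z h1 h2 h3 h4
    have h5 : (z - p) ^ m ≠ 0 := zpow_ne_zero _ (sub_ne_zero.2 h4)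
    rw [h2, h3] at h1
    simp only [smul_eq_mul] at h1
    rw [div_zpow, Function.comp]
    field_simp
    linear_combination h1
  have := tendsto_nhds_unique (L.congr' key) R
  exact mul_right_cancel₀ hgp this

/-- The order of the square `U` of a solution at `i` is `1 ± 2 κ_i`, hence even, since `κ_i` is half
of an odd integer. So the leading coefficient at `i` changes sign under `S`. -/
theorem eq_neg_one_of_slash_S_eq {Q U : ℂ → ℂ} {κ : ℝ} {μ : ℂ} (hκ : HasLocalExponents Q I κ)
    (hκ' : ∀ m : ℤ, κ ≠ m) (hU : MeromorphicAt U I) (hsq : SquareEq Q U I)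
    (htop : meromorphicOrderAt U I ≠ ⊤) (h : ∀ᶠ z in 𝓝[≠] I, z ^ 2 * U (-1 / z) = μ * U z) :
    μ = -1 := by
  obtain ⟨m, hm⟩ := WithTop.ne_top_iff_exists.1 htop
  have hd := hasDerivAt_neg_one_div I_ne_zero
  have h1 := sq_mul_zpow_eq_of_fixed_point hU hm.symm hd (by simp [neg_div]) (by simp) h
  have hord := hsq.order_sub_one_sq hU hκ hm.symm
  have heven : Even m := by
    rw [← Int.not_odd_iff_even]
    rintro ⟨k, rfl⟩
    rcases sq_eq_sq_iff_eq_or_eq_neg.1 hord with h2 | h2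
    · exact hκ' k (by push_cast at h2; linarith)
    · exact hκ' (-k) (by push_cast at h2 ⊢; linarith)
  rw [← h1]
  simp [heven.neg_one_zpow]

theorem rho_sq : rho ^ 2 = rho - 1 := by
  have h : ((√3 : ℝ) : ℂ) ^ 2 = 3 := by
    rw [← Complex.ofReal_pow, Real.sq_sqrt (by norm_num)]; norm_num
  rw [rho]
  linear_combination (1 / 4 : ℂ) * I ^ 2 * h + (3 / 4 : ℂ) * I_sq

theorem rho_im : 0 < rho.im := by
  have : rho.im = √3 / 2 := by simp [rho]
  rw [this]
  positivity

theorem three_dvd_of_rho_zpow {k : ℤ} (h : (rho ^ 2) ^ k = 1) : (3 : ℤ) ∣ k := by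
  have h0 : rho ≠ 0 := fun h0 => by have := rho_im; simp [h0] at this
  have h6 : (rho ^ 2) ^ (3 : ℤ) = 1 := by
    have : (rho ^ 2) ^ 3 = 1 := by
      have h3 : rho ^ 3 = -1 := by linear_combination (rho + 1) * rho_sq
      linear_combination (rho ^ 3 - 1) * h3
    exact_mod_cast this
  have hk : (rho ^ 2) ^ (k % 3) = 1 := by
    have := h
    rw [← Int.mul_ediv_add_emod k 3, zpow_add₀ (pow_ne_zero 2 h0), zpow_mul, h6, one_zpow,
      one_mul] at this
    exact this
  have hcases : k % 3 = 0 ∨ k % 3 = 1 ∨ k % 3 = 2 := by omega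
  rcases hcases with h1 | h1 | h1
  · exact Int.dvd_of_emod_eq_zero h1
  · exfalso
    rw [h1, zpow_one, rho_sq] at hk
    have := congrArg Complex.im hk
    simp at this
    exact absurd this rho_im.ne'
  · exfalso
    rw [h1] at hk
    have h2 : (rho ^ 2) ^ 2 = 1 := by exact_mod_cast hk
    have h3 : -rho = 1 := by
      rw [← h2]; linear_combination (-rho ^ 2 - rho) * rho_sq
    have := congrArg Complex.im h3
    simp at this
    exact absurd this rho_im.ne'

/-- The square `U` of a solution is not invariant under the elliptic element `z ↦ 1 - 1 / z` fixing
`ρ`: its order at `ρ` would be `1` modulo `3`, that is `2 κ_ρ` would be divisible by `3`. -/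
theorem not_invariant_at_rho {Q U : ℂ → ℂ} {κ : ℝ} (hκ : HasLocalExponents Q rho κ)
    (hκ' : ∀ m : ℤ, 2 * κ / 3 ≠ m) (hU : MeromorphicAt U rho) (hsq : SquareEq Q U rho)
    (htop : meromorphicOrderAt U rho ≠ ⊤) :
    ¬ ∀ᶠ z in 𝓝[≠] rho, z ^ 2 * U (-1 / z + 1) = U z := by
  intro h
  obtain ⟨m, hm⟩ := WithTop.ne_top_iff_exists.1 htop
  have h0 : rho ≠ 0 := fun h0 => by have := rho_im; simp [h0] at this
  have hd := (hasDerivAt_neg_one_div h0).add_const 1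
  have h1 := sq_mul_zpow_eq_of_fixed_point (μ := 1) hU hm.symm hd
    (by field_simp; linear_combination -rho_sq) (by simp [h0]) (by simpa using h)
  have hord := hsq.order_sub_one_sq hU hκ hm.symm
  have h2 : (rho ^ 2) ^ (m - 1) = 1 := by
    rw [one_div, inv_zpow] at h1
    have h3 : (rho ^ 2) ^ m ≠ 0 := zpow_ne_zero _ (pow_ne_zero _ h0)
    have h4 : rho ^ 2 = (rho ^ 2) ^ m := by field_simp at h1; exact h1
    rw [zpow_sub_one₀ (pow_ne_zero 2 h0), ← h4, mul_inv_cancel₀ (pow_ne_zero 2 h0)]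
  obtain ⟨k, hk⟩ := three_dvd_of_rho_zpow h2
  have hk' : (m : ℝ) - 1 = 3 * k := by exact_mod_cast hk
  rcases sq_eq_sq_iff_eq_or_eq_neg.1 hord with h3 | h3
  · exact hκ' k (by linarith)
  · exact hκ' (-k) (by push_cast; linarith)

/-! ### Frobenius solutions at the cusp -/

/-- A Frobenius solution is `q ^ s h(q)` with `h` holomorphic at `q = 0` and `h 0 = 1`. -/
theorem IsFrobeniusSolution.exists_analyticAt {Q y : ℂ → ℂ} {s Y : ℝ}
    (hy : IsFrobeniusSolution Q s Y y) :
    ∃ h : ℂ → ℂ, AnalyticAt ℂ h 0 ∧ h 0 = 1 ∧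
      ∀ z : ℂ, Y < z.im → y z = exp (2 * π * I * s * z) * h (nome z) := by
  obtain ⟨-, c, hc0, hc⟩ := hy
  have hpi : (π : ℂ) ≠ 0 := by exact_mod_cast Real.pi_ne_zero
  have hsum : ∀ x ∈ Metric.ball (0 : ℂ) (Real.exp (-(2 * π * Y))),
      HasSum (fun j => c j * x ^ j) (∑' j, c j * x ^ j) := by
    intro x hx
    rcases eq_or_ne x 0 with rfl | hx0
    · refine (summable_of_ne_finset_zero (s := {0}) fun j hj => ?_).hasSum
      simp only [Finset.mem_singleton] at hj
      simp [hj]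
    · have hnz : nome (log x / (2 * π * I)) = x := by
        rw [nome, mul_div_cancel₀ _ (by simp [hpi, I_ne_zero]), exp_log hx0]
      have him : Y < (log x / (2 * π * I)).im := by
        rw [← hnz, mem_ball_zero_iff, norm_nome, Real.exp_lt_exp] at hx
        have := Real.pi_pos
        nlinarith
      have := (hc _ him).summable.hasSum
      rwa [hnz] at this
  refine ⟨fun x => ∑' j, c j * x ^ j,
    (hasSum_deriv_of_hasSum_ball hsum 0 (Metric.mem_ball_self (Real.exp_pos _))).1, ?_, ?_⟩
  · beta_reduce
    rw [tsum_eq_single 0]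
    · simp [hc0]
    · intro j hj; simp [hj]
  · intro z hz
    beta_reduce
    rw [(hc z hz).tsum_eq, mul_comm (y z), ← mul_assoc, ← exp_add]
    simp

theorem nome_add_one (z : ℂ) : nome (z + 1) = nome z := by
  rw [nome, mul_add, mul_one, exp_add, exp_two_pi_mul_I, mul_one, nome]

/-- The square of a solution `q ^ (k / 4) h(q)`, `k` odd, changes sign under `T`. -/
theorem IsFrobeniusSolution.sq_add_one {Q y : ℂ → ℂ} {s Y : ℝ} {k : ℤ}
    (hy : IsFrobeniusSolution Q s Y y) (hs : s = k / 4) (hk : Odd k) {z : ℂ} (hz : Y < z.im) :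
    y (z + 1) ^ 2 = -y z ^ 2 := by
  obtain ⟨h, -, -, hyh⟩ := hy.exists_analyticAt
  have e : exp (2 * π * I * s * (z + 1)) ^ 2 = -exp (2 * π * I * s * z) ^ 2 := by
    rw [← exp_nat_mul, ← exp_nat_mul]
    have : ((2 : ℕ) : ℂ) * (2 * π * I * s * (z + 1)) =
        (2 : ℕ) * (2 * π * I * s * z) + k * (π * I) := by
      rw [hs]; push_cast; ring
    rw [this, exp_add, exp_int_mul, exp_pi_mul_I, hk.neg_one_zpow]
    ring
  rw [hyh z hz, hyh (z + 1) (by simpa using hz), nome_add_one, mul_pow, e, mul_pow]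
  ring

/-- The constant Wronskian of the two Frobenius solutions is seen at the cusp, where it tends to
`4 π i s`. -/
theorem wronskian_frobenius_ne_zero {Q f g : ℂ → ℂ} {s Y : ℝ} (hs : s ≠ 0)
    (hf : IsFrobeniusSolution Q (-s) Y f) (hg : IsFrobeniusSolution Q s Y g) :
    ∀ z : ℂ, Y < z.im → wronskian f g z ≠ 0 := by
  have key : ∃ z : ℂ, Y < z.im ∧ wronskian f g z ≠ 0 := by
    obtain ⟨a, ha, ha0, hfa⟩ := hf.exists_analyticAt
    obtain ⟨b, hb, hb0, hgb⟩ := hg.exists_analyticAt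
    have hpi : (π : ℂ) ≠ 0 := by exact_mod_cast Real.pi_ne_zero
    have hcont : ContinuousAt (fun x => a x * (s * b x + x * deriv b x)
        - (-s * a x + x * deriv a x) * b x) 0 := by
      have h1 := ha.continuousAt
      have h2 := hb.continuousAt
      have h3 := ha.deriv.continuousAt
      have h4 := hb.deriv.continuousAt
      fun_prop
    have hne := hcont.eventually_ne (y := 0) (by
      simp only [ha0, hb0]
      have : (s : ℂ) ≠ 0 := by exact_mod_cast hs
      simpa [← two_mul] using this)
    obtain ⟨Y', hY', hall⟩ := eventually_im_gt_iff.1 (tendsto_nome.eventually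
      ((hne.and ha.eventually_analyticAt).and hb.eventually_analyticAt))
    have hz : ∃ z : ℂ, max Y Y' < z.im := ⟨((max Y Y' + 1 : ℝ) : ℂ) * I, by simp⟩
    obtain ⟨z, hz⟩ := hz
    have hzY := (le_max_left _ _).trans_lt hz
    obtain ⟨⟨hW, haz⟩, hbz⟩ := hall z ((le_max_right _ _).trans_lt hz)
    have hder : ∀ {t : ℝ} {h y : ℂ → ℂ}, AnalyticAt ℂ h (nome z) →
        (∀ z : ℂ, Y < z.im → y z = exp (2 * π * I * t * z) * h (nome z)) →
        deriv y z = 2 * π * I * exp (2 * π * I * t * z) *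
          (t * h (nome z) + nome z * deriv h (nome z)) := by
      intro t h y hh hy
      have hev : y =ᶠ[𝓝 z] fun z => exp (2 * π * I * t * z) * h (nome z) := by
        filter_upwards [(isOpen_im_gt Y).mem_nhds hzY] with x hx using hy x hx
      rw [hev.deriv_eq]
      refine (((((hasDerivAt_id z).const_mul (2 * π * I * t)).cexp).mul
        (hh.differentiableAt.hasDerivAt.comp z (hasDerivAt_nome z))).congr_deriv ?_).deriv
      simp only [Function.comp, id]
      ring
    refine ⟨z, hzY, ?_⟩
    have hE : exp (2 * π * I * ((-s : ℝ) : ℂ) * z) * exp (2 * π * I * s * z) = 1 := by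
      rw [← exp_add]; push_cast; simp
    have hval : wronskian f g z = 2 * π * I *
        (a (nome z) * (s * b (nome z) + nome z * deriv b (nome z))
        - (-s * a (nome z) + nome z * deriv a (nome z)) * b (nome z)) := by
      simp only [wronskian, hder haz hfa, hder hbz hgb, hfa z hzY, hgb z hzY]
      push_cast at hE ⊢
      linear_combination (2 * π * I *
        (a (nome z) * (s * b (nome z) + nome z * deriv b (nome z))
        - (-s * a (nome z) + nome z * deriv a (nome z)) * b (nome z))) * hE
    rw [hval]
    exact mul_ne_zero (by simp [hpi, I_ne_zero]) hW
  obtain ⟨z₀, hz₀, hW⟩ := key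
  intro z hz
  rwa [hf.1.wronskian_eq (isOpen_im_gt Y) (convex_halfSpace_im_gt Y).isPreconnected hg.1 hz hz₀]

/-! ### The operation of `S` on squares of solutions -/

theorem IsLocalSol.combination_ne_zero {Q f g : ℂ → ℂ} {z₀ : ℂ} (hf : IsLocalSol Q f z₀)
    (hg : IsLocalSol Q g z₀) (hW : wronskian f g z₀ ≠ 0) {x y : ℂ} (hxy : x ≠ 0 ∨ y ≠ 0) :
    ¬ ∀ᶠ z in 𝓝[≠] z₀, x * f z + y * g z = 0 := by
  intro h
  have h1 : (fun z => x * f z + y * g z) =ᶠ[𝓝 z₀] fun _ => 0 :=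
    eventuallyEq_nhds_of_meromorphicNFAt (hf.combination hg x y).1.meromorphicNFAt
      analyticAt_const.meromorphicNFAt h
  have h2 : x * f z₀ + y * g z₀ = 0 := h1.eq_of_nhds
  have h3 : x * deriv f z₀ + y * deriv g z₀ = 0 := by
    have h4 := h1.deriv_eq
    rw [deriv_const] at h4
    rw [← h4]
    exact (((hf.1.differentiableAt.hasDerivAt.const_mul x).add
      (hg.1.differentiableAt.hasDerivAt.const_mul y)).deriv).symm
  rcases hxy with hx | hy
  · refine hW (mul_left_cancel₀ hx ?_)
    simp only [wronskian]
    linear_combination deriv g z₀ * h2 - g z₀ * h3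
  · refine hW (mul_left_cancel₀ hy ?_)
    simp only [wronskian]
    linear_combination f z₀ * h3 - deriv f z₀ * h2

/-- The meromorphic functions `A`, `B`, `C` on the upper half-plane are the continuations of the
products `f ^ 2`, `f g`, `g ^ 2` of two linearly independent solutions `f`, `g` near `z₀`. -/
structure IsSquareTriple (Q : ℂ → ℂ) (z₀ : ℂ) (f g A B C : ℂ → ℂ) : Prop where
  mem : z₀ ∈ H
  left : IsLocalSol Q f z₀
  right : IsLocalSol Q g z₀
  wronskian_ne : wronskian f g z₀ ≠ 0
  nfA : MeromorphicNFOn A H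
  nfB : MeromorphicNFOn B H
  nfC : MeromorphicNFOn C H
  eqA : A =ᶠ[𝓝[≠] z₀] fun z => f z ^ 2
  eqB : B =ᶠ[𝓝[≠] z₀] fun z => f z * g z
  eqC : C =ᶠ[𝓝[≠] z₀] fun z => g z ^ 2

namespace IsSquareTriple

variable {Q f g A B C : ℂ → ℂ} {z₀ : ℂ}

theorem meromorphicOn_comb (h : IsSquareTriple Q z₀ f g A B C) (x y : ℂ) :
    MeromorphicOn (fun z => x ^ 2 * A z + 2 * x * y * B z + y ^ 2 * C z) H :=
  (((MeromorphicOn.const _).mul h.nfA.meromorphicOn).add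
    ((MeromorphicOn.const _).mul h.nfB.meromorphicOn)).add
    ((MeromorphicOn.const _).mul h.nfC.meromorphicOn)

theorem comb_eq (h : IsSquareTriple Q z₀ f g A B C) (x y : ℂ) :
    (fun z => x ^ 2 * A z + 2 * x * y * B z + y ^ 2 * C z) =ᶠ[𝓝[≠] z₀]
      fun z => (x * f z + y * g z) ^ 2 := by
  filter_upwards [h.eqA, h.eqB, h.eqC] with z h1 h2 h3
  rw [h1, h2, h3]
  ring

theorem squareEq_comb (h : IsSquareTriple Q z₀ f g A B C) (hQ : MeromorphicOn Q H) (x y : ℂ)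
    {z : ℂ} (hz : z ∈ H) :
    SquareEq Q (fun z => x ^ 2 * A z + 2 * x * y * B z + y ^ 2 * C z) z :=
  SquareEq.of_isPreconnected isPreconnected_H hQ (h.meromorphicOn_comb x y) h.mem hz
    ((h.left.combination h.right x y).squareEq (h.comb_eq x y))

theorem order_comb_ne_top (h : IsSquareTriple Q z₀ f g A B C) {x y : ℂ} (hxy : x ≠ 0 ∨ y ≠ 0)
    {z : ℂ} (hz : z ∈ H) :
    meromorphicOrderAt (fun z => x ^ 2 * A z + 2 * x * y * B z + y ^ 2 * C z) z ≠ ⊤ := by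
  refine (h.meromorphicOn_comb x y).meromorphicOrderAt_ne_top_of_isPreconnected isPreconnected_H
    h.mem hz ?_
  intro htop
  rw [meromorphicOrderAt_eq_top_iff] at htop
  refine h.left.combination_ne_zero h.right h.wronskian_ne hxy ?_
  filter_upwards [htop, h.comb_eq x y] with z h1 h2
  rw [h2] at h1
  exact pow_eq_zero_iff (two_ne_zero) |>.1 h1

/-- Near each regular point the three functions are again the products of two solutions, with the
same Wronskian: this is encoded in `B ^ 2 = A C` and `A C' - A' C = 2 W B`. -/
theorem exists_lifts (h : IsSquareTriple Q z₀ f g A B C) (hQ : MeromorphicOn Q H) {z₁ : ℂ}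
    (hz₁ : z₁ ∈ H) (hQz₁ : AnalyticAt ℂ Q z₁) :
    ∃ v w : ℂ → ℂ, IsLocalSol Q v z₁ ∧ IsLocalSol Q w z₁ ∧
      (A =ᶠ[𝓝[≠] z₁] fun z => v z ^ 2) ∧ (B =ᶠ[𝓝[≠] z₁] fun z => v z * w z) ∧
      (C =ᶠ[𝓝[≠] z₁] fun z => w z ^ 2) ∧ wronskian v w z₁ = wronskian f g z₀ := by
  have hA := h.nfA.meromorphicOn
  have hB := h.nfB.meromorphicOn
  have hC := h.nfC.meromorphicOn
  have hsqA : SquareEq Q A z₁ := by simpa using h.squareEq_comb hQ 1 0 hz₁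
  have hsqC : SquareEq Q C z₁ := by simpa using h.squareEq_comb hQ 0 1 hz₁
  have hA0 : ∀ᶠ z in 𝓝[≠] z₁, A z ≠ 0 := by
    refine (meromorphicOrderAt_ne_top_iff_eventually_ne_zero (hA z₁ hz₁)).1 ?_
    simpa using h.order_comb_ne_top (x := 1) (y := 0) (Or.inl one_ne_zero) hz₁
  have hC0 : ∀ᶠ z in 𝓝[≠] z₁, C z ≠ 0 := by
    refine (meromorphicOrderAt_ne_top_iff_eventually_ne_zero (hC z₁ hz₁)).1 ?_
    simpa using h.order_comb_ne_top (x := 0) (y := 1) (Or.inr one_ne_zero) hz₁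
  have hBB : (fun z => B z ^ 2) =ᶠ[𝓝[≠] z₁] fun z => A z * C z := by
    refine eventuallyEq_nhdsNE_of_isPreconnected isPreconnected_H (hB.pow 2) (hA.mul hC) h.mem hz₁
      ?_
    filter_upwards [h.eqA, h.eqB, h.eqC] with z h1 h2 h3
    simp only [Pi.pow_apply, Pi.mul_apply]
    rw [h1, h2, h3]
    ring
  have hWB : (fun z => A z * deriv C z - deriv A z * C z) =ᶠ[𝓝[≠] z₁]
      fun z => 2 * wronskian f g z₀ * B z := by
    refine eventuallyEq_nhdsNE_of_isPreconnected isPreconnected_H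
      ((hA.mul hC.deriv).sub (hA.deriv.mul hC)) ((MeromorphicOn.const _).mul hB) h.mem hz₁ ?_
    filter_upwards [h.eqA, h.eqB, h.eqC, h.eqA.nhdsNE_deriv, h.eqC.nhdsNE_deriv,
      (eventually_deriv_sq h.left.1).filter_mono nhdsWithin_le_nhds,
      (eventually_deriv_sq h.right.1).filter_mono nhdsWithin_le_nhds,
      (h.left.eventually_wronskian_eq h.right).filter_mono nhdsWithin_le_nhds]
      with z h1 h2 h3 h4 h5 h6 h7 h8
    simp only [Pi.sub_apply, Pi.mul_apply]
    rw [h1, h2, h3, h4, h5, h6.1, h7.1, ← h8, wronskian]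
    ring
  obtain ⟨v, hv, hAv⟩ := hsqA.exists_isLocalSol hQz₁ (h.nfA hz₁)
  obtain ⟨w, hw, hCw⟩ := hsqC.exists_isLocalSol hQz₁ (h.nfC hz₁)
  -- the sign of `w` is adjusted to that of `B`
  obtain ⟨w', hw', hCw', hB'⟩ : ∃ w' : ℂ → ℂ, IsLocalSol Q w' z₁ ∧
      (C =ᶠ[𝓝 z₁] fun z => w' z ^ 2) ∧ B =ᶠ[𝓝[≠] z₁] fun z => v z * w' z := by
    have hm : MeromorphicAt (fun z => B z - v z * w z) z₁ :=
      (hB z₁ hz₁).sub (hv.1.mul hw.1).meromorphicAt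
    rcases hm.eventually_eq_zero_or_eventually_ne_zero with h0 | h0
    · exact ⟨w, hw, hCw, h0.mono fun z hz => sub_eq_zero.1 hz⟩
    · refine ⟨fun z => 0 * v z + (-1) * w z, hv.combination hw 0 (-1), ?_, ?_⟩
      · filter_upwards [hCw] with z hz
        rw [hz]; ring
      · filter_upwards [h0, hBB, hAv.filter_mono nhdsWithin_le_nhds,
          hCw.filter_mono nhdsWithin_le_nhds] with z h1 h2 h3 h4
        apply mul_left_cancel₀ h1
        rw [h3, h4] at h2
        linear_combination h2
  have hAv' := hAv.filter_mono (nhdsWithin_le_nhds (s := {z₁}ᶜ))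
  have hCw'' := hCw'.filter_mono (nhdsWithin_le_nhds (s := {z₁}ᶜ))
  refine ⟨v, w', hv, hw', hAv', hB', hCw'', ?_⟩
  obtain ⟨z, h1, h2, h3, h4, h5, h6, h7, h8, h9, h10, h11⟩ := (hWB.and (hAv'.and (hB'.and
    (hCw''.and (hAv'.nhdsNE_deriv.and (hCw''.nhdsNE_deriv.and
    (((eventually_deriv_sq hv.1).filter_mono nhdsWithin_le_nhds).and
    (((eventually_deriv_sq hw'.1).filter_mono nhdsWithin_le_nhds).and
    (((hv.eventually_wronskian_eq hw').filter_mono nhdsWithin_le_nhds).and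
    (hA0.and hC0)))))))))).exists
  simp only at h1
  rw [h2, h3, h4, h5, h6, h7.1, h8.1] at h1
  rw [h2] at h10
  rw [h4] at h11
  have hv0 : v z ≠ 0 := fun h0 => h10 (by simp [h0])
  have hw0 : w' z ≠ 0 := fun h0 => h11 (by simp [h0])
  rw [← h9]
  apply mul_left_cancel₀ (mul_ne_zero two_ne_zero (mul_ne_zero hv0 hw0))
  rw [wronskian]
  linear_combination h1

/-- The operation of `S` on the solutions, given by a matrix of determinant one, and the induced
operation on their squares. -/
theorem exists_slash_S (h : IsSquareTriple Q z₀ f g A B C) (hQ : MeromorphicOn Q H)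
    (hQz₀ : AnalyticAt ℂ Q z₀) (hS : ∀ z ∈ H, Q (-1 / z) = z ^ (4 : ℤ) * Q z) :
    ∃ a b c d : ℂ, a * d - b * c = 1 ∧ ∀ x y : ℂ, ∀ᶠ z in 𝓝[≠] z₀,
      z ^ 2 * (x ^ 2 * A (-1 / z) + 2 * x * y * B (-1 / z) + y ^ 2 * C (-1 / z))
        = (x * (a * f z + b * g z) + y * (c * f z + d * g z)) ^ 2 := by
  have hz₁ := neg_one_div_mem_H h.mem
  have hne := ne_zero_of_mem_H h.mem
  have hinv : -1 / (-1 / z₀) = z₀ := by field_simp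
  have hQz₁ : AnalyticAt ℂ Q (-1 / z₀) := by
    have h1 : AnalyticAt ℂ (fun x => Q (-1 / x) / x ^ (4 : ℤ)) (-1 / z₀) := by
      have h2 := ne_zero_of_mem_H hz₁
      refine AnalyticAt.div (AnalyticAt.fun_comp (by rwa [hinv]) (analyticAt_neg_one_div h2))
        (analyticAt_id.zpow h2) (zpow_ne_zero _ h2)
    refine h1.congr ?_
    filter_upwards [isOpen_H.mem_nhds hz₁] with x hx
    have h2 := ne_zero_of_mem_H hx
    rw [hS x hx]
    field_simp
  obtain ⟨v, w, hv, hw, hA, hB, hC, hW⟩ := h.exists_lifts hQ hz₁ hQz₁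
  have hv' := hv.slash_S hS h.mem
  have hw' := hw.slash_S hS h.mem
  obtain ⟨a, b, hab⟩ := h.left.exists_eq_combination h.right hv'.1 h.wronskian_ne
  obtain ⟨c, d, hcd⟩ := h.left.exists_eq_combination h.right hw'.1 h.wronskian_ne
  refine ⟨a, b, c, d, ?_, fun x y => ?_⟩
  · have h1 := wronskian_slash_S hS h.mem hv hw
    rw [hW] at h1
    have hda : ∀ s t : ℂ, deriv (fun x => s * f x + t * g x) z₀
        = s * deriv f z₀ + t * deriv g z₀ := fun s t =>
      ((h.left.1.differentiableAt.hasDerivAt.const_mul s).add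
        (h.right.1.differentiableAt.hasDerivAt.const_mul t)).deriv
    rw [wronskian, hab.deriv_eq, hcd.deriv_eq, hda, hda, hab.eq_of_nhds, hcd.eq_of_nhds] at h1
    apply mul_right_cancel₀ h.wronskian_ne
    rw [wronskian] at h1 ⊢
    linear_combination h1
  · have ht : Tendsto (fun z : ℂ => -1 / z) (𝓝[≠] z₀) (𝓝[≠] (-1 / z₀)) :=
      (hasDerivAt_neg_one_div hne).tendsto_nhdsNE (by simp [hne])
    filter_upwards [ht.eventually hA, ht.eventually hB, ht.eventually hC,
      hab.filter_mono nhdsWithin_le_nhds, hcd.filter_mono nhdsWithin_le_nhds]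
      with z h1 h2 h3 h4 h5
    rw [h1, h2, h3, ← h4, ← h5]
    ring

/-- The identity theorem carries a transformation law under `S` from `z₀` to the whole upper
half-plane, in particular to the elliptic points. -/
theorem slash_S_comb_of_eventually (h : IsSquareTriple Q z₀ f g A B C) {x y μ : ℂ}
    (hμ : ∀ᶠ z in 𝓝[≠] z₀,
      z ^ 2 * (x ^ 2 * A (-1 / z) + 2 * x * y * B (-1 / z) + y ^ 2 * C (-1 / z))
        = μ * (x * f z + y * g z) ^ 2) {z : ℂ} (hz : z ∈ H) :
    ∀ᶠ z in 𝓝[≠] z, z ^ 2 * (x ^ 2 * A (-1 / z) + 2 * x * y * B (-1 / z) + y ^ 2 * C (-1 / z))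
        = μ * (x ^ 2 * A z + 2 * x * y * B z + y ^ 2 * C z) := by
  refine eventuallyEq_nhdsNE_of_isPreconnected isPreconnected_H
    (f := fun z => z ^ 2 * (x ^ 2 * A (-1 / z) + 2 * x * y * B (-1 / z) + y ^ 2 * C (-1 / z)))
    (g := fun z => μ * (x ^ 2 * A z + 2 * x * y * B z + y ^ 2 * C z)) ?_
    ((MeromorphicOn.const μ).mul (h.meromorphicOn_comb x y)) h.mem hz ?_
  · intro p hp
    refine ((MeromorphicAt.id p).pow 2).mul ?_
    exact (h.meromorphicOn_comb x y _ (neg_one_div_mem_H hp)).comp_analyticAt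
      (analyticAt_neg_one_div (ne_zero_of_mem_H hp))
  · filter_upwards [hμ, h.comb_eq x y] with z h1 h2
    rw [h1, h2]

/-- The linear algebra of the theorem. Every eigenvalue `λ` of the matrix `(a b; c d)` of `S` has
`λ ^ 2 = -1` by the local analysis at `i`, so that `a + d = 0`. If `c` were zero, then `g ^ 2` would
be invariant under the element of order three fixing `ρ`. Hence `A + (b / c) C` is defined, and it
is an eigenvector of `S` with eigenvalue `-1`. -/
theorem exists_anti_invariant (h : IsSquareTriple Q z₀ f g A B C) (hQ : MeromorphicOn Q H)
    (hQz₀ : AnalyticAt ℂ Q z₀) (hS : ∀ z ∈ H, Q (-1 / z) = z ^ (4 : ℤ) * Q z)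
    (hT : ∀ z ∈ H, C (z + 1) = -C z) (h2 : ConditionH2 Q) :
    ∃ β : ℂ, ∀ᶠ z in 𝓝[≠] z₀, z ^ 2 * (A (-1 / z) + β * C (-1 / z)) = -(A z + β * C z) := by
  obtain ⟨κi, hκi, hκi'⟩ := h2.angle_I
  obtain ⟨κρ, hκρ, hκρ'⟩ := h2.angle_rho
  have hI : I ∈ H := by simp [mem_H]
  have hρ : rho ∈ H := rho_im
  obtain ⟨a, b, c, d, hdet, hslash⟩ := h.exists_slash_S hQ hQz₀ hS
  -- an eigenvector of the matrix of `S` has an eigenvalue with square `-1`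
  have heig : ∀ x y μ : ℂ, (x ≠ 0 ∨ y ≠ 0) → x * a + y * c = μ * x → x * b + y * d = μ * y →
      (∀ᶠ z in 𝓝[≠] z₀, z ^ 2 * (x ^ 2 * A (-1 / z) + 2 * x * y * B (-1 / z)
        + y ^ 2 * C (-1 / z)) = μ ^ 2 * (x * f z + y * g z) ^ 2) ∧ μ ^ 2 = -1 := by
    intro x y μ hxy h1 h3
    have hμ : ∀ᶠ z in 𝓝[≠] z₀, z ^ 2 * (x ^ 2 * A (-1 / z) + 2 * x * y * B (-1 / z)
        + y ^ 2 * C (-1 / z)) = μ ^ 2 * (x * f z + y * g z) ^ 2 := by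
      filter_upwards [hslash x y] with z hz
      rw [hz, ← mul_pow]
      congr 1
      linear_combination f z * h1 + g z * h3
    exact ⟨hμ, eq_neg_one_of_slash_S_eq hκi hκi' (h.meromorphicOn_comb x y I hI)
      (h.squareEq_comb hQ x y hI) (h.order_comb_ne_top hxy hI)
      (h.slash_S_comb_of_eventually hμ hI)⟩
  have hc : c ≠ 0 := by
    rintro rfl
    obtain ⟨hμ, hd⟩ := heig 0 1 d (Or.inr one_ne_zero) (by ring) (by ring)
    refine not_invariant_at_rho hκρ hκρ' (h.meromorphicOn_comb 0 1 rho hρ)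
      (h.squareEq_comb hQ 0 1 hρ) (h.order_comb_ne_top (Or.inr one_ne_zero) hρ) ?_
    filter_upwards [h.slash_S_comb_of_eventually hμ hρ,
      nhdsWithin_le_nhds (isOpen_H.mem_nhds hρ)] with z h1 hz
    have h3 := hT _ (neg_one_div_mem_H hz)
    rw [hd] at h1
    rw [h3]
    linear_combination -h1
  obtain ⟨μ, hμ⟩ := IsAlgClosed.exists_root
    (Polynomial.X ^ 2 - Polynomial.C (a + d) * Polynomial.X + 1 : Polynomial ℂ) (by
      have : (Polynomial.X ^ 2 - Polynomial.C (a + d) * Polynomial.X + 1 : Polynomial ℂ).degree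
          = 2 := by compute_degree!
      rw [this]; norm_num)
  have hμ' : μ ^ 2 - (a + d) * μ + 1 = 0 := by simpa [Polynomial.IsRoot] using hμ
  have hμ2 := (heig c (μ - a) μ (Or.inl hc) (by ring)
    (by linear_combination -hμ' - hdet)).2
  have htr : a + d = 0 := by
    have hμ0 : μ ≠ 0 := by rintro rfl; simp at hμ2
    apply mul_right_cancel₀ hμ0
    linear_combination -hμ' + hμ2
  have had : d = -a := by linear_combination htr
  subst had
  refine ⟨b / c, ?_⟩
  filter_upwards [hslash 1 0, hslash 0 1, h.eqA, h.eqC] with z h1 h3 h4 h5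
  have e : z ^ 2 * (A (-1 / z) + b / c * C (-1 / z))
      = (a * f z + b * g z) ^ 2 + b / c * (c * f z + -a * g z) ^ 2 := by
    linear_combination h1 + b / c * h3
  rw [e, h4, h5]
  field_simp
  linear_combination (-c * f z ^ 2 - b * g z ^ 2) * hdet

end IsSquareTriple

/-! ### The modular form -/

theorem meromorphicNFOn_slash_S {F : ℂ → ℂ} (hF : MeromorphicNFOn F H) :
    MeromorphicNFOn (fun z => z ^ 2 * F (-1 / z)) H := by
  intro z hz
  have h0 := ne_zero_of_mem_H hz
  exact (meromorphicNFAt_mul_iff_right (g := fun z => z ^ 2) (analyticAt_id.pow 2)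
    (pow_ne_zero 2 h0)).2 ((hF (neg_one_div_mem_H hz)).comp_analyticAt (analyticAt_neg_one_div h0))

theorem meromorphicNFOn_neg {F : ℂ → ℂ} {U : Set ℂ} (hF : MeromorphicNFOn F U) :
    MeromorphicNFOn (fun z => -F z) U := by
  intro z hz
  have := (meromorphicNFAt_mul_iff_right (g := fun _ => (-1 : ℂ)) analyticAt_const
    (neg_ne_zero.2 one_ne_zero)).2 (hF hz)
  refine (meromorphicNFAt_congr (Filter.Eventually.of_forall fun x => ?_)).1 this
  simp

theorem add_one_mem_H {z : ℂ} (hz : z ∈ H) : z + 1 ∈ H := by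
  simpa [mem_H] using hz

theorem meromorphicNFOn_add_one {F : ℂ → ℂ} (hF : MeromorphicNFOn F H) :
    MeromorphicNFOn (fun z => F (z + 1)) H := fun _ hz =>
  meromorphicNFAt_comp_add_const_iff_meromorphicNFAt.2 (hF (add_one_mem_H hz))

theorem slash_eq_of_generators {k : ℤ} {f : ℍ → ℂ} (hS : f ∣[k] ModularGroup.S = f)
    (hT : f ∣[k] ModularGroup.T = f) (γ : SL(2, ℤ)) : f ∣[k] γ = f := by
  have hγ : γ ∈ Subgroup.closure {ModularGroup.S, ModularGroup.T} := by
    simp [SpecialLinearGroup.SL2Z_generators]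
  induction hγ using Subgroup.closure_induction with
  | one => exact SlashAction.slash_one k f
  | mem g hg =>
    rcases hg with rfl | rfl
    · exact hS
    · exact hT
  | mul g h _ _ ig ih => rw [SlashAction.slash_mul, ig, ih]
  | inv g _ ig =>
    conv_lhs => rw [← ig]
    rw [← SlashAction.slash_mul, mul_inv_cancel, SlashAction.slash_one]

/-- If `F` is anti-invariant under the generators `S` and `T` in weight `-2`, and `F ^ 2` is
meromorphic at the cusp, then `F ^ 2` is a meromorphic modular form of weight `-4`. -/
theorem isMeromorphicModularForm_sq {F : ℂ → ℂ} (hF : MeromorphicNFOn F H)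
    (hT : onH F ∣[(-2 : ℤ)] ModularGroup.T = -onH F)
    (hS : onH F ∣[(-2 : ℤ)] ModularGroup.S = -onH F)
    (hcusp : ∃ g : ℂ → ℂ, MeromorphicAt g 0 ∧
      ∃ Y : ℝ, ∀ z : ℂ, Y < z.im → F z ^ 2 = g (nome z)) :
    IsMeromorphicModularForm (-4) (fun z => F z ^ 2) := by
  have hsq : onH (fun z => F z ^ 2) = onH F * onH F := by
    funext τ; simp [onH, sq]
  have key : ∀ γ : SL(2, ℤ), onH F ∣[(-2 : ℤ)] γ = -onH F →
      onH (fun z => F z ^ 2) ∣[(-4 : ℤ)] γ = onH (fun z => F z ^ 2) := by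
    intro γ hγ
    rw [hsq, show (-4 : ℤ) = -2 + -2 by norm_num, ModularForm.mul_slash_SL2, hγ, neg_mul_neg]
  refine ⟨fun z hz => ?_, slash_eq_of_generators (key _ hS) (key _ hT), hcusp⟩
  have := (hF hz).zpow (n := 2)
  exact_mod_cast this

theorem sq_frobenius_eq {f g F : ℂ → ℂ} {a b : ℂ → ℂ} {n : ℕ} {Y : ℝ} {β : ℂ}
    (hf : ∀ z : ℂ, Y < z.im → f z = exp (2 * π * I * ((-((n : ℝ) / 4) : ℝ) : ℂ) * z) * a (nome z))
    (hg : ∀ z : ℂ, Y < z.im → g z = exp (2 * π * I * (((n : ℝ) / 4 : ℝ) : ℂ) * z) * b (nome z))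
    (hF : ∀ z : ℂ, Y < z.im → F z = f z ^ 2 + β * g z ^ 2) :
    ∀ z : ℂ, Y < z.im → F z ^ 2 =
      nome z ^ (-n : ℤ) * (a (nome z) ^ 2 + β * nome z ^ n * b (nome z) ^ 2) ^ 2 := by
  intro z hz
  set e := exp (2 * π * I * (((n : ℝ) / 4 : ℝ) : ℂ) * z) with he
  have he0 : e ≠ 0 := exp_ne_zero _
  have e1 : exp (2 * π * I * ((-((n : ℝ) / 4) : ℝ) : ℂ) * z) = e⁻¹ := by
    rw [he, ← exp_neg]
    congr 1
    push_cast
    ring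
  have e2 : nome z ^ n = e ^ 4 := by
    rw [he, nome, ← exp_nat_mul, ← exp_nat_mul]
    congr 1
    push_cast
    ring
  rw [hF z hz, hf z hz, hg z hz, e1, ← he, zpow_neg, zpow_natCast, e2]
  field_simp

end ModularODE

open ModularODE in
theorem theorem1p2 (Q : ℂ → ℂ) (hQ : ModularODE.IsMeromorphicModularForm 4 Q)
    (n : ℕ) (hn : Odd n)
    (h1 : ModularODE.ConditionH1 Q ((n : ℝ) / 4)) (h2 : ModularODE.ConditionH2 Q) :
    (∃ Y : ℝ, 0 ≤ Y ∧ ∃ yminus yplus : ℂ → ℂ,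
      ModularODE.IsFrobeniusSolution Q (-((n : ℝ) / 4)) Y yminus ∧
      ModularODE.IsFrobeniusSolution Q ((n : ℝ) / 4) Y yplus) ∧
    ∀ Y : ℝ, 0 ≤ Y → ∀ yminus yplus : ℂ → ℂ,
      ModularODE.IsFrobeniusSolution Q (-((n : ℝ) / 4)) Y yminus →
      ModularODE.IsFrobeniusSolution Q ((n : ℝ) / 4) Y yplus →
      ∃ Gminus Gplus : ℂ → ℂ,
        ModularODE.IsSquareOfContinuation Q Y yminus Gminus ∧
        ModularODE.IsSquareOfContinuation Q Y yplus Gplus ∧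
        ∃ (c : ℂ) (F : ℂ → ℂ),
          MeromorphicNFOn F ModularODE.H ∧
          (∀ z ∈ ModularODE.H, AnalyticAt ℂ Q z → F z = Gminus z + c * Gplus z) ∧
          ModularODE.onH F ∣[(-2 : ℤ)] ModularGroup.T = -ModularODE.onH F ∧
          ModularODE.onH F ∣[(-2 : ℤ)] ModularGroup.S = -ModularODE.onH F ∧
          ModularODE.IsMeromorphicModularForm (-4) (fun z => F z ^ 2) := by
  refine ⟨exists_isFrobeniusSolution_pair hn h1.exponents_at_infty, ?_⟩
  intro Y hY yminus yplus hm hp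
  have hQT := hQ.apply_add_intCast
  have hQS := hQ.apply_neg_one_div
  have hQm := hQ.meromorphic.meromorphicOn
  have hext : ∀ p ∈ H, ∃ r : ℝ, 0 < r ∧ ExtendsSquares Q p r := by
    intro p hp
    by_cases hpole : IsPole Q p
    · obtain ⟨κ, ⟨m, -, hκ⟩, -, hlog, -⟩ := h1.apparent p hp hpole
      exact exists_extendsSquares_of_noLogAt hpole hκ hlog
    · exact exists_extendsSquares_of_analyticAt
        ((hQ.meromorphic hp).meromorphicOrderAt_nonneg_iff_analyticAt.1 (not_lt.1 hpole))
  obtain ⟨A, hA⟩ := exists_isSquareOfContinuation hQ.meromorphic hQT hext hY hm.1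
  obtain ⟨C, hC⟩ := exists_isSquareOfContinuation hQ.meromorphic hQT hext hY hp.1
  obtain ⟨D, hD⟩ := exists_isSquareOfContinuation hQ.meromorphic hQT hext hY
    (hm.1.add (isOpen_im_gt Y) hp.1)
  have hAm := hA.meromorphic.meromorphicOn
  have hCm := hC.meromorphic.meromorphicOn
  have hDm := hD.meromorphic.meromorphicOn
  -- the product of the two solutions, by polarization
  obtain ⟨B, hB, hBeq⟩ := exists_meromorphicNFOn_eventuallyEq (f := fun z => (D z - A z - C z) / 2)
    (((hDm.sub hAm).sub hCm).div (MeromorphicOn.const 2))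
  refine ⟨A, C, hA, hC, ?_⟩
  obtain ⟨z₀, hz₀, hQz₀⟩ := exists_mem_analyticAt (Q := Q) (isOpen_im_gt Y)
    ⟨((Y + 1 : ℝ) : ℂ) * I, by simp⟩ (fun z hz => hQm z (hY.trans_lt hz))
  have hz₀H : z₀ ∈ H := hY.trans_lt hz₀
  have hnear : ∀ᶠ z in 𝓝[≠] z₀, Y < z.im := nhdsWithin_le_nhds ((isOpen_im_gt Y).mem_nhds hz₀)
  have hn0 : (n : ℝ) / 4 ≠ 0 := by
    have := hn.pos
    positivity
  have htriple : IsSquareTriple Q z₀ yminus yplus A B C :=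
    { mem := hz₀H
      left := hm.1.isLocalSol (isOpen_im_gt Y) hz₀
      right := hp.1.isLocalSol (isOpen_im_gt Y) hz₀
      wronskian_ne := wronskian_frobenius_ne_zero hn0 hm hp z₀ hz₀
      nfA := hA.meromorphic
      nfB := hB
      nfC := hC.meromorphic
      eqA := hnear.mono fun z hz => hA.eq_sq z hz
      eqB := by
        filter_upwards [hnear, hBeq z₀ hz₀H] with z hz hz'
        rw [hz', hA.eq_sq z hz, hC.eq_sq z hz, hD.eq_sq z hz]
        ring
      eqC := hnear.mono fun z hz => hC.eq_sq z hz }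
  have hTtop : ∀ z : ℂ, Y < z.im → A (z + 1) = -A z ∧ C (z + 1) = -C z := by
    intro z hz
    have hz' : Y < (z + 1).im := by simpa using hz
    rw [hA.eq_sq z hz, hA.eq_sq _ hz', hC.eq_sq z hz, hC.eq_sq _ hz']
    exact ⟨hm.sq_add_one (k := -n) (by push_cast; ring) (by simpa using hn) hz,
      hp.sq_add_one (k := n) (by push_cast; ring) (by simpa using hn) hz⟩
  have hCT : ∀ z ∈ H, C (z + 1) = -C z :=
    eqOn_of_meromorphicNFOn isPreconnected_H (meromorphicNFOn_add_one hC.meromorphic)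
      (meromorphicNFOn_neg hC.meromorphic) hz₀H (hnear.mono fun z hz => (hTtop z hz).2)
  obtain ⟨β, hβ⟩ := htriple.exists_anti_invariant hQm hQz₀ hQS hCT h2
  obtain ⟨F, hF, hFeq⟩ := exists_meromorphicNFOn_eventuallyEq (f := fun z => A z + β * C z)
    (hAm.add ((MeromorphicOn.const β).mul hCm))
  have hFtop : ∀ z : ℂ, Y < z.im → F z = yminus z ^ 2 + β * yplus z ^ 2 := by
    intro z hz
    refine (eventuallyEq_nhds_of_meromorphicNFAt (hF (hY.trans_lt hz))
      (g := fun z => yminus z ^ 2 + β * yplus z ^ 2) (((hm.1.1 z hz).pow 2).add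
      (analyticAt_const.mul ((hp.1.1 z hz).pow 2))).meromorphicNFAt ?_).eq_of_nhds
    filter_upwards [hFeq z (hY.trans_lt hz),
      nhdsWithin_le_nhds ((isOpen_im_gt Y).mem_nhds hz)] with x hx hx'
    rw [hx, hA.eq_sq x hx', hC.eq_sq x hx']
  have hFT : ∀ z ∈ H, F (z + 1) = -F z := by
    refine eqOn_of_meromorphicNFOn isPreconnected_H (meromorphicNFOn_add_one hF)
      (meromorphicNFOn_neg hF) hz₀H ?_
    filter_upwards [hnear] with z hz
    have hz' : Y < (z + 1).im := by simpa using hz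
    have h3 := hTtop z hz
    rw [hA.eq_sq z hz, hA.eq_sq _ hz', hC.eq_sq z hz, hC.eq_sq _ hz'] at h3
    rw [hFtop z hz, hFtop _ hz', h3.1, h3.2]
    ring
  have hFS : ∀ z ∈ H, z ^ 2 * F (-1 / z) = -F z := by
    refine eqOn_of_meromorphicNFOn isPreconnected_H (meromorphicNFOn_slash_S hF)
      (meromorphicNFOn_neg hF) hz₀H ?_
    have hne := ne_zero_of_mem_H hz₀H
    have ht : Tendsto (fun z : ℂ => -1 / z) (𝓝[≠] z₀) (𝓝[≠] (-1 / z₀)) :=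
      (hasDerivAt_neg_one_div hne).tendsto_nhdsNE (by simp [hne])
    filter_upwards [hβ, hFeq z₀ hz₀H, ht.eventually (hFeq _ (neg_one_div_mem_H hz₀H))]
      with z h3 h4 h5
    rw [h4, h5, h3]
  have hslashT : onH F ∣[(-2 : ℤ)] ModularGroup.T = -onH F := by
    funext τ
    rw [onH_slash_T_apply]
    exact hFT τ τ.2
  have hslashS : onH F ∣[(-2 : ℤ)] ModularGroup.S = -onH F := by
    funext τ
    rw [onH_slash_S_apply, mul_comm]
    exact hFS τ τ.2
  refine ⟨β, F, hF, fun z hz hQz => ?_, hslashT, hslashS,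
    isMeromorphicModularForm_sq hF hslashT hslashS ?_⟩
  · obtain ⟨U, hU, hzU, v, hv, hAv⟩ := hA.locally_sq z hz hQz
    obtain ⟨V, hV, hzV, w, hw, hCw⟩ := hC.locally_sq z hz hQz
    have hAa : AnalyticAt ℂ A z :=
      ((hv.1 z hzU).pow 2).congr
        (Filter.eventually_of_mem (hU.mem_nhds hzU) fun x hx => (hAv x hx).symm)
    have hCa : AnalyticAt ℂ C z :=
      ((hw.1 z hzV).pow 2).congr
        (Filter.eventually_of_mem (hV.mem_nhds hzV) fun x hx => (hCw x hx).symm)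
    exact (eventuallyEq_nhds_of_meromorphicNFAt (hF hz)
      (hAa.add (analyticAt_const.mul hCa)).meromorphicNFAt (hFeq z hz)).eq_of_nhds
  · obtain ⟨a, ha, -, hma⟩ := hm.exists_analyticAt
    obtain ⟨b, hb, -, hpb⟩ := hp.exists_analyticAt
    refine ⟨fun x => x ^ (-n : ℤ) * (a x ^ 2 + β * x ^ n * b x ^ 2) ^ 2, ?_, Y,
      sq_frobenius_eq hma hpb hFtop⟩
    exact ((MeromorphicAt.id 0).zpow (-n : ℤ)).mul (((ha.pow 2).add
      ((analyticAt_const.mul (analyticAt_id.pow n)).mul (hb.pow 2))).pow 2).meromorphicAt
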